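/- **Setting.** A parametric timed game (PTG) $G=(L,X,P,Act,T_c,T_u,\ell_0,Inv)$ has locations $L$, clocks $X$, parameters $P$, labels $Act$, disjoint finite sets $T_c,T_u$ of controllable and uncontrollable transitions $t=(\ell,g,a,Y,\ell')$, an initial location $\ell_0$ and invariants $Inv(\ell)$. Guards and invariants are conjunctions of constraints $x\sim plt$ and $plt'\sim plt$, with $x$ a clock, $plt,plt'$ linear terms over $P$ with rational coefficients, and ${\sim}\in\{<,\le,=,\ge,>\}$. A state is $(\ell,v)$ with $v=(v_X,v_P)\in\mathbb R_{\ge0}^X\times\mathbb Q_{\ge0}^P$ and $v\models Inv(\ell)$; $\mathbb S$ is the set of states. For $s,s'\in\mathbb S$: $s\to^\delta s'$ ($\delta\ge 0$) if $s'$ is $s$ with all clocks increased by $\delta$; $s\to^t s'$ if $s$ is in the source of $t$ and satisfies its guard, and $s'$ is obtained by moving to the target and resetting the clocks in $Y$. $\xi_0$ is the set of states in $\ell_0$ with all clocks $0$. **Winning.** Histories are finite sequences of states $s_0s_1\dots$ alternating timed steps $s_{2i}\to^\delta s_{2i+1}$ and discrete steps $s_{2i+1}\to^t s_{2i+2}$.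 A strategy of the controller (environment) maps each history to a delay in $[0,\infty]$ or to a transition of $T_c$ ($T_u$) such that a returned transition is enabled in the last state with its target invariant satisfied, and after a returned finite delay that is possible a transition is returned. Two strategies are combined with priority to the environment's transition, then the controller's transition, then the smaller delay. The combination induces a run from every state (a transition chosen at an even position is preceded by a null delay; the run ends when the chosen delay is infinite or violates the invariant). For a set $R\subseteq L$ of target locations, a run is winning if its coverage (states traversed by its timed steps, and by delays from its last state if it is finite) meets $R$. A state is winning if some controller strategy makes the induced run from it winning against every environment strategy. A parameter valuation $v_P$ is winning if $(\ell_0,(\vec0,v_P))$ is a state and is winning. **Algorithm.** A symbolic state $\xi=(\ell,Z)$ is a location with a set of valuations satisfying $Inv(\ell)$, identified with a set of states. Write $\xi^{\nearrow}$ for its timed successors, $Succ(t,\xi)$ for its discrete successors, $post_t(\xi)=Succ(t,\xi)^{\nearrow}$, and $Pred(t,S)$ for the discrete predecessors of a set $S$ of states; $SafePred(S_1,S_2)$ is the set of states that can reach $S_1$ by a timed step whose traversed states (endpoints included) avoid $S_2$. Initially $WaitingExplore=\{\xi_0^{\nearrow}\}$, $Explored=WaitingUpdate=\emptyset$, all $Win[\xi]$,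 $Depends[\xi]$ and $WinningParam$ are empty. While a waiting list is nonempty, one of the following is performed (nondeterministically): * *Explore:* extract $\xi$ from $WaitingExplore$. For each transition $t$ whose source is the location of $\xi$, let $\xi'=post_t(\xi)$, add $\xi$ to $Depends[\xi']$ and, if $\xi'\notin Explored$, add $\xi'$ to $WaitingExplore$. If the location of $\xi$ is in $R$, set $Win[\xi]:=\xi$ and add $Depends[\xi]$ to $WaitingUpdate$. Finally add $\xi$ to $WaitingUpdate$ and to $Explored$. * *Update:* extract $\xi$ from $WaitingUpdate$. With $t$ ranging over transitions whose source is the location of $\xi$, let $U=\bigcup_{t\in T_u}Pred(t,post_t(\xi)\setminus Win[post_t(\xi)])$, $M=\bigcup_{t\in T_c}Pred(t,Win[post_t(\xi)])$ and $N=SafePred(Win[\xi]\cup M,U)\cap\xi$. If $N\not\subseteq Win[\xi]$, add $Depends[\xi]$ to $WaitingUpdate$ and $N$ to $Win[\xi]$. Then report $WinningParam:=\{v_P : \exists (\ell,(v_X,v_P))\in Win[\xi]\cap\xi_0\}$. An execution is *fair* if every symbolic state that is in $WaitingExplore$ (resp. $WaitingUpdate$) at some time is extracted from that list at that time or later. **Theorem.**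 Let $G$ be a PTG, $R\subseteq L$, and consider any complete (terminating or infinite) execution of the algorithm. 1. (Sound) Every parameter valuation reported in $WinningParam$ at any time is winning. 2. If the execution is fair, then for every symbolic state $\xi$ that is explored at some time and every winning state $s\in\xi$, there is a time from which on $s\in Win[\xi]$. 3. (Complete in the limit) If the execution is fair, every winning parameter valuation is reported in $WinningParam$ at some time. -/

import Mathlib

open scoped NNReal ENNReal

/-! ### Linear terms, guards, valuations -/

/-- Linear terms over the parameters `P`: `k`, `k * p`, sums. -/
inductive LinTerm (P : Type*) where
  | const (k : ℚ) : LinTerm P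
  | mul (k : ℚ) (p : P) : LinTerm P
  | add (a b : LinTerm P) : LinTerm P

/-- Comparison symbols `<, ≤, =, ≥, >`. -/
inductive Cmp where
  | lt | le | eq | ge | gt

/-- Guards: `⊤`, conjunctions, `x ~ plt`, `plt' ~ plt`. -/
inductive Guard (X P : Type*) where
  | top : Guard X P
  | and (φ ψ : Guard X P) : Guard X P
  | clock (x : X) (c : Cmp) (a : LinTerm P) : Guard X P
  | param (a : LinTerm P) (c : Cmp) (b : LinTerm P) : Guard X P

/-- A valuation of the game: nonnegative real clock values, nonnegative rational parameters. -/
@[ext]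
structure GameVal (X P : Type*) where
  clock : X → ℝ≥0
  param : P → ℚ≥0

def LinTerm.eval {P : Type*} (v : P → ℚ≥0) : LinTerm P → ℚ
  | .const k => k
  | .mul k p => k * (v p : ℚ)
  | .add a b => a.eval v + b.eval v

def Cmp.holds : Cmp → ℝ → ℝ → Prop
  | .lt, a, b => a < b
  | .le, a, b => a ≤ b
  | .eq, a, b => a = b
  | .ge, a, b => a ≥ b
  | .gt, a, b => a > b

/-- `v ⊨ φ`. -/
def Guard.sat {X P : Type*} (v : GameVal X P) : Guard X P → Prop
  | .top => True
  | .and φ ψ => φ.sat v ∧ ψ.sat v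
  | .clock x c a => c.holds (v.clock x : ℝ) (a.eval v.param : ℝ)
  | .param a c b => c.holds (a.eval v.param : ℝ) (b.eval v.param : ℝ)

/-- `v + δ`. -/
def GameVal.delay {X P : Type*} (v : GameVal X P) (δ : ℝ≥0) : GameVal X P :=
  ⟨fun x => v.clock x + δ, v.param⟩

open Classical in
/-- `v[Y := 0]`. -/
noncomputable def GameVal.reset {X P : Type*} (v : GameVal X P) (Y : Set X) :
    GameVal X P :=
  ⟨fun x => if x ∈ Y then 0 else v.clock x, v.param⟩

/-! ### Parametric timed games and their transition relations -/

/-- A transition `(ℓ, g, a, Y, ℓ')`. -/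
structure Transition (L X P A : Type*) where
  source : L
  guard : Guard X P
  label : A
  resets : Set X
  target : L

/-- A parametric timed game with locations `L`, clocks `X`, parameters `P`, labels `A`.
There are finitely many transitions; nothing else has to be finite. -/
structure PTG (L X P A : Type*) where
  /-- controllable transitions -/
  ctrl : Set (Transition L X P A)
  /-- uncontrollable transitions -/
  unctrl : Set (Transition L X P A)
  ctrl_finite : ctrl.Finite
  unctrl_finite : unctrl.Finite
  disjoint : Disjoint ctrl unctrl
  /-- initial location -/
  init : L
  /-- location invariants -/
  inv : L → Guard X P

/-- A location together with a valuation; it is a state of `G` if it lies in `G.stateSpace`. -/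
@[ext]
structure State (L X P : Type*) where
  loc : L
  val : GameVal X P

namespace PTG

variable {L X P A : Type*}

/-- The state space `𝕊`. -/
def stateSpace (G : PTG L X P A) : Set (State L X P) :=
  {s | (G.inv s.loc).sat s.val}

/-- The timed transition `s →^δ s'`. -/
def Timed (G : PTG L X P A) (δ : ℝ≥0) (s s' : State L X P) : Prop :=
  s ∈ G.stateSpace ∧ s' ∈ G.stateSpace ∧ s'.loc = s.loc ∧ s'.val = s.val.delay δ

/-- The discrete transition `s →^t s'`. -/
def Disc (G : PTG L X P A) (t : Transition L X P A) (s s' : State L X P) : Prop :=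
  s ∈ G.stateSpace ∧ s' ∈ G.stateSpace ∧ s.loc = t.source ∧ s'.loc = t.target ∧
    t.guard.sat s.val ∧ s'.val = s.val.reset t.resets

/-- The initial states `ξ₀`: initial location, all clocks `0`, invariant satisfied. -/
def initStates (G : PTG L X P A) : Set (State L X P) :=
  {s | s ∈ G.stateSpace ∧ s.loc = G.init ∧ ∀ x, s.val.clock x = 0}

/-- `Cover(s →^δ s')` (which depends only on `s` and `δ`). -/
def coverStep (G : PTG L X P A) (s : State L X P) (δ : ℝ≥0) : Set (State L X P) :=
  {s'' | ∃ δ' : ℝ≥0, δ' ≤ δ ∧ G.Timed δ' s s''}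

/-- `Cover(s)`. -/
def coverState (G : PTG L X P A) (s : State L X P) : Set (State L X P) :=
  {s' | ∃ δ : ℝ≥0, G.Timed δ s s'}

/-- The coverage of a finite or infinite sequence of states `r 0, r 1, …`
(`r n = none` once the sequence has ended): the coverage of its timed transitions (from even to
odd positions) and, if it is finite, that of its last state. -/
def coverRun (G : PTG L X P A) (r : ℕ → Option (State L X P)) : Set (State L X P) :=
  {s'' | (∃ (i : ℕ) (s s' : State L X P) (δ : ℝ≥0), r (2 * i) = some s ∧
            r (2 * i + 1) = some s' ∧ G.Timed δ s s' ∧ s'' ∈ G.coverStep s δ) ∨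
         (∃ (n : ℕ) (s : State L X P), r n = some s ∧ r (n + 1) = none ∧
            s'' ∈ G.coverState s)}

/-- The run `r` visits the reachability objective `R`. -/
def WinningRun (G : PTG L X P A) (R : Set L) (r : ℕ → Option (State L X P)) : Prop :=
  ∃ s ∈ G.coverRun r, s.loc ∈ R

end PTG

/-! ### Histories, strategies, winning states -/

/-- A nonempty finite sequence of states, split into its last state and the earlier ones
(in chronological order). -/
structure History (L X P : Type*) where
  past : List (State L X P)
  last : State L X P

/-- The sequence with one more state at the end. -/
def History.extend {L X P : Type*} (h : History L X P) (s : State L X P) : History L X P :=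
  ⟨h.past ++ [h.last], s⟩

/-- The index `i` of the last state of `s₀ … sᵢ`. -/
def History.index {L X P : Type*} (h : History L X P) : ℕ := h.past.length

/-- A decision: wait (possibly forever) or take a discrete transition. -/
inductive Move (L X P A : Type*) where
  | wait (d : ℝ≥0∞) : Move L X P A
  | act (t : Transition L X P A) : Move L X P A

namespace PTG

variable {L X P A : Type*}

/-- The histories of the game (from arbitrary states): finite sequences of states that alternate
between timed transitions (leaving even positions) and discrete ones (leaving odd positions). -/
inductive IsHistory (G : PTG L X P A) : History L X P → Prop where
  | start (s : State L X P) : s ∈ G.stateSpace → IsHistory G ⟨[], s⟩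
  | timed (h : History L X P) (δ : ℝ≥0) (s : State L X P) : IsHistory G h → Even h.index →
      G.Timed δ h.last s → IsHistory G (h.extend s)
  | disc (h : History L X P) (t : Transition L X P A) (s : State L X P) : IsHistory G h →
      Odd h.index → t ∈ G.ctrl ∪ G.unctrl → G.Disc t h.last s → IsHistory G (h.extend s)

/-- `σ` is a strategy for the player who owns the transitions `T`. A transition that is returned
is available; after a finite delay that was returned and is available, a transition is returned.
(A delay can be appended to a history at even positions only.) -/
structure IsStrategy (G : PTG L X P A) (T : Set (Transition L X P A))
    (σ : History L X P → Move L X P A) : Prop where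
  avail : ∀ h, G.IsHistory h → ∀ t, σ h = .act t →
    t ∈ T ∧ h.last.loc = t.source ∧ t.guard.sat h.last.val ∧
      (G.inv t.target).sat (h.last.val.reset t.resets)
  altern : ∀ h, G.IsHistory h → Even h.index → ∀ (δ : ℝ≥0) (s : State L X P),
    σ h = .wait δ → G.Timed δ h.last s → ∃ t, σ (h.extend s) = .act t

end PTG

/-- The global strategy of a controller strategy and an environment strategy: the environment has
priority among discrete transitions, discrete transitions have priority over delays, and
the shorter of two delays is taken. -/
noncomputable def globalStrategy {L X P A : Type*} (σc σe : History L X P → Move L X P A)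
    (h : History L X P) : Move L X P A :=
  match σe h, σc h with
  | .act t, _ => .act t
  | .wait _, .act t => .act t
  | .wait d', .wait d => .wait (min d d')

/-- The position of a play under construction: the history so far, and the transition that has
to be taken next if it was chosen before the null delay inserted in front of it. -/
structure PlayState (L X P A : Type*) where
  hist : History L X P
  pending : Option (Transition L X P A)

/-- The state reached by the discrete transition `t`. -/
noncomputable def Transition.fire {L X P A : Type*} (t : Transition L X P A)
    (s : State L X P) : State L X P :=
  ⟨t.target, s.val.reset t.resets⟩

namespace PTG

variable {L X P A : Type*}

open Classical in
/-- One step of the run induced by the global strategy `σ`; `none` means that the run ends. -/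
noncomputable def nextPlay (G : PTG L X P A) (σ : History L X P → Move L X P A)
    (p : PlayState L X P A) : Option (PlayState L X P A) :=
  match p.pending with
  | some t => some ⟨p.hist.extend (t.fire p.hist.last), none⟩
  | none =>
    if Even p.hist.index then
      match σ p.hist with
      | .act t => some ⟨p.hist.extend p.hist.last, some t⟩
      | .wait d =>
        if d ≠ ⊤ ∧ (G.inv p.hist.last.loc).sat (p.hist.last.val.delay d.toNNReal) then
          some ⟨p.hist.extend ⟨p.hist.last.loc, p.hist.last.val.delay d.toNNReal⟩, none⟩
        else none
    else
      match σ p.hist with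
      | .act t => some ⟨p.hist.extend (t.fire p.hist.last), none⟩
      | .wait _ => none -- does not occur for strategies

/-- The play induced by `σ` from `s₀` after `n` steps. -/
noncomputable def play (G : PTG L X P A) (σ : History L X P → Move L X P A)
    (s₀ : State L X P) : ℕ → Option (PlayState L X P A)
  | 0 => some ⟨⟨[], s₀⟩, none⟩
  | n + 1 => (G.play σ s₀ n).bind (G.nextPlay σ)

/-- The run induced by the global strategy `σ` from `s₀`. -/
noncomputable def inducedRun (G : PTG L X P A) (σ : History L X P → Move L X P A)
    (s₀ : State L X P) (n : ℕ) : Option (State L X P) :=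
  (G.play σ s₀ n).map fun p => p.hist.last

/-- `s` is a winning state: some controller strategy wins against all environment strategies. -/
def Winning (G : PTG L X P A) (R : Set L) (s : State L X P) : Prop :=
  s ∈ G.stateSpace ∧ ∃ σc, G.IsStrategy G.ctrl σc ∧
    ∀ σe, G.IsStrategy G.unctrl σe → G.WinningRun R (G.inducedRun (globalStrategy σc σe) s)

/-- The parameter valuation `p` is winning: the corresponding initial state is winning. -/
def WinningParam (G : PTG L X P A) (R : Set L) (p : P → ℚ≥0) : Prop :=
  ∃ s ∈ G.initStates, s.val.param = p ∧ G.Winning R s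

/-! ### Symbolic states and their operations -/

/-- Symbolic states `(ℓ, Z)` with `Z ⊆ Inv(ℓ)`; the zone is identified with the set of valuations
that it denotes. -/
@[ext]
structure SymState (G : PTG L X P A) where
  loc : L
  zone : Set (GameVal X P)
  sub : ∀ v ∈ zone, (G.inv loc).sat v

/-- The set of concrete states denoted by a symbolic state. -/
def SymState.states {G : PTG L X P A} (ξ : G.SymState) : Set (State L X P) :=
  {s | s.loc = ξ.loc ∧ s.val ∈ ξ.zone}

/-- `ξ₀` as a symbolic state. -/
def symInit (G : PTG L X P A) : G.SymState where
  loc := G.init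
  zone := {v | (G.inv G.init).sat v ∧ ∀ x, v.clock x = 0}
  sub _ hv := hv.1

/-- Temporal successors. -/
def tempSucc (G : PTG L X P A) (ξ : G.SymState) : G.SymState where
  loc := ξ.loc
  zone := {v' | ∃ s ∈ ξ.states, ∃ δ : ℝ≥0, G.Timed δ s ⟨ξ.loc, v'⟩}
  sub := by
    rintro v' ⟨s, -, δ, -, h, -⟩
    exact h

/-- Discrete successors `Succ(t, ξ)`. -/
def succ (G : PTG L X P A) (t : Transition L X P A) (ξ : G.SymState) : G.SymState where
  loc := t.target
  zone := {v' | ∃ s ∈ ξ.states, G.Disc t s ⟨t.target, v'⟩}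
  sub := by
    rintro v' ⟨s, -, -, h, -⟩
    exact h

/-- The successor of `ξ` in the parametric zone graph along `t`. -/
def post (G : PTG L X P A) (t : Transition L X P A) (ξ : G.SymState) : G.SymState :=
  G.tempSucc (G.succ t ξ)

/-- Discrete predecessors `Pred(t, S)`. -/
def pred (G : PTG L X P A) (t : Transition L X P A) (S : Set (State L X P)) :
    Set (State L X P) :=
  {s | ∃ s' ∈ S, G.Disc t s s'}

/-- `SafePred(S₁, S₂)`: states that can reach `S₁` by a timed transition avoiding `S₂`. -/
def safePred (G : PTG L X P A) (S₁ S₂ : Set (State L X P)) : Set (State L X P) :=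
  {s | ∃ s' ∈ S₁, ∃ δ : ℝ≥0, G.Timed δ s s' ∧ G.coverStep s δ ∩ S₂ = ∅}

/-- Projection onto the parameters. -/
def projParam (S : Set (State L X P)) : Set (P → ℚ≥0) :=
  {p | ∃ s ∈ S, s.val.param = p}

/-! ### The algorithm -/

/-- The variables of the algorithm. -/
structure AlgState (G : PTG L X P A) where
  explored : Set G.SymState
  waitingUpdate : Set G.SymState
  waitingExplore : Set G.SymState
  win : G.SymState → Set (State L X P)
  depends : G.SymState → Set G.SymState
  winningParam : Set (P → ℚ≥0)

/-- The initial values of the variables. -/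
def algInit (G : PTG L X P A) : G.AlgState where
  explored := ∅
  waitingUpdate := ∅
  waitingExplore := {G.tempSucc G.symInit}
  win := fun _ => ∅
  depends := fun _ => ∅
  winningParam := ∅

/-- `ξ' = TempSucc(Succ(t, ξ))` for some transition `t` that leaves the location of `ξ`. -/
def IsSucc (G : PTG L X P A) (ξ ξ' : G.SymState) : Prop :=
  ∃ t ∈ G.ctrl ∪ G.unctrl, t.source = ξ.loc ∧ ξ' = G.post t ξ

/-- `Depends` after the loop over the transitions from `ξ` in `explore`. -/
def exploreDepends (G : PTG L X P A) (ξ : G.SymState) (c : G.AlgState) (ξ' : G.SymState) :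
    Set G.SymState :=
  c.depends ξ' ∪ {η | η = ξ ∧ G.IsSucc ξ ξ'}

open Classical in
/-- The procedure `explore`, where `ξ` is extracted from `waitingExplore`. -/
noncomputable def explore (G : PTG L X P A) (R : Set L) (ξ : G.SymState) (c : G.AlgState) :
    G.AlgState where
  explored := c.explored ∪ {ξ}
  waitingExplore := (c.waitingExplore \ {ξ}) ∪ {ξ' | G.IsSucc ξ ξ' ∧ ξ' ∉ c.explored}
  depends := G.exploreDepends ξ c
  win := if ξ.loc ∈ R then Function.update c.win ξ ξ.states else c.win
  waitingUpdate :=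
    (if ξ.loc ∈ R then c.waitingUpdate ∪ G.exploreDepends ξ c ξ else c.waitingUpdate) ∪ {ξ}
  winningParam := c.winningParam

/-- The set `Uncontrollable` computed by `update`. -/
def updUncontrollable (G : PTG L X P A) (ξ : G.SymState) (c : G.AlgState) :
    Set (State L X P) :=
  {s | ∃ t ∈ G.unctrl, t.source = ξ.loc ∧
    s ∈ G.pred t ((G.post t ξ).states \ c.win (G.post t ξ))}

/-- The set `WinningMoves` computed by `update`. -/
def updWinningMoves (G : PTG L X P A) (ξ : G.SymState) (c : G.AlgState) :
    Set (State L X P) :=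
  {s | ∃ t ∈ G.ctrl, t.source = ξ.loc ∧ s ∈ G.pred t (c.win (G.post t ξ))}

/-- The set `NewWin` computed by `update`. -/
def newWin (G : PTG L X P A) (ξ : G.SymState) (c : G.AlgState) : Set (State L X P) :=
  G.safePred (c.win ξ ∪ G.updWinningMoves ξ c) (G.updUncontrollable ξ c) ∩ ξ.states

open Classical in
/-- `Win` after `update`. -/
noncomputable def updateWin (G : PTG L X P A) (ξ : G.SymState) (c : G.AlgState) :
    G.SymState → Set (State L X P) :=
  if G.newWin ξ c ⊆ c.win ξ then c.win
  else Function.update c.win ξ (c.win ξ ∪ G.newWin ξ c)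

open Classical in
/-- The procedure `update`, where `ξ` is extracted from `waitingUpdate`. -/
noncomputable def update (G : PTG L X P A) (ξ : G.SymState) (c : G.AlgState) :
    G.AlgState where
  explored := c.explored
  waitingExplore := c.waitingExplore
  depends := c.depends
  win := G.updateWin ξ c
  waitingUpdate :=
    if G.newWin ξ c ⊆ c.win ξ then c.waitingUpdate \ {ξ}
    else (c.waitingUpdate \ {ξ}) ∪ c.depends ξ
  winningParam := projParam (G.updateWin ξ c ξ ∩ G.initStates)

/-- What one iteration of the main loop does: explore or update an extracted symbolic state. -/
inductive Choice (G : PTG L X P A) where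
  | explore (ξ : G.SymState) : Choice G
  | update (ξ : G.SymState) : Choice G

/-- One iteration of the main loop; `none` stands for idling after termination, which is reached
exactly when both waiting lists are empty. -/
inductive AlgStep (G : PTG L X P A) (R : Set L) :
    G.AlgState → Option G.Choice → G.AlgState → Prop where
  | explore (c : G.AlgState) (ξ : G.SymState) : ξ ∈ c.waitingExplore →
      AlgStep G R c (some (.explore ξ)) (G.explore R ξ c)
  | update (c : G.AlgState) (ξ : G.SymState) : ξ ∈ c.waitingUpdate →
      AlgStep G R c (some (.update ξ)) (G.update ξ c)
  | done (c : G.AlgState) : c.waitingExplore = ∅ → c.waitingUpdate = ∅ →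
      AlgStep G R c none c

/-- A complete execution of the algorithm: the values `conf n` of the variables before iteration
`n`, and the choices `act n` made; a terminated execution is continued by idling. -/
structure Execution (G : PTG L X P A) (R : Set L) where
  conf : ℕ → G.AlgState
  act : ℕ → Option G.Choice
  start : conf 0 = G.algInit
  step : ∀ n, G.AlgStep R (conf n) (act n) (conf (n + 1))

/-- The waiting lists are treated fairly: every symbolic state in a waiting list is eventually
extracted from it. -/
def Execution.Fair {G : PTG L X P A} {R : Set L} (E : G.Execution R) : Prop :=
  (∀ n, ∀ ξ ∈ (E.conf n).waitingExplore, ∃ m ≥ n, E.act m = some (.explore ξ)) ∧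
  (∀ n, ∀ ξ ∈ (E.conf n).waitingUpdate, ∃ m ≥ n, E.act m = some (.update ξ))

end PTG

/-!
Soundness and completeness of the on-the-fly algorithm for parametric timed games.

*Soundness.* Let the attractor of index `n + 1` consist of the states in `R` and of the states with a
delay to a controllable transition into the attractor of index `n` such that no uncontrollable
transition on the way leaves the latter. The winning sets after `n` iterations lie in the attractor of
index `n` (`PTG.Execution.win_subset_attractor`). The controller wins from every attractor by
following these delays and transitions, because the index drops in each round
(`PTG.winning_of_mem_attractor`); guards are convex, so a delay of the controller that the environment
cuts short stays inside the invariant.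

*Completeness.* The pairs of an explored symbolic state `ξ` and a state of `ξ` that never enters
`Win[ξ]` should form a trap, in which the environment can keep the play
(`PTG.not_winning_of_trap`). This fails for a naive passage to the limit: along one delay, each
iteration might provide a different obstacle. What saves it is that parameters are rational. For a
fixed parameter valuation, all constants are multiples of some `1 / D` and at most `D`, so there are
finitely many clock regions over the finitely many clocks that occur in guards, and each `Win[ξ]` is a
union of regions inside `ξ` (`PTG.Execution.regionInvariant`). Hence `Win[ξ]`, restricted to that
valuation, is eventually constant (`PTG.Execution.exists_win_stable`), and by fairness `ξ` is updated
after its successors have become so (`PTG.Execution.exists_update_stable`). The number of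
symbolic states need not be finite.

Regions are encoded by reparametrizations of time: two valuations are equivalent if an
automorphism of the real line that fixes the present and commutes with translation by `1 / D` carries
the reset times of the one to those of the other, up to clocks beyond `D`
(`GameVal.SameRegion`). That this is a time-abstract bisimulation is immediate, as delays are
translations and resets put a clock at the fixed point. Finiteness of the index is the
extension result `exists_orderIso_of_floor_sub_eq`.
-/

/-! ### Piecewise linear reparametrizations of time -/

/-- Two finite families of reals whose differences have the same integer parts are related by an
automorphism of the real line that commutes with translation by `1`. It is the maximum of the maps
`t ↦ b i + φ (t - a i)`, where `φ` fixes the integers and is so convex on each period that every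
such map stays below the prescribed values. -/
theorem exists_orderIso_of_floor_sub_eq {ι : Type*} [Finite ι] [Nonempty ι] (a b : ι → ℝ)
    (h : ∀ i j, ⌊a i - a j⌋ = ⌊b i - b j⌋) :
    ∃ g : ℝ ≃o ℝ, (∀ t, g (t + 1) = g t + 1) ∧ ∀ i, g (a i) = b i := by
  have := Fintype.ofFinite ι
  have hfr : ∀ i j, 0 < Int.fract (a i - a j) → 0 < Int.fract (b i - b j) := by
    intro i j hij
    refine (Int.fract_nonneg _).lt_of_ne fun h0 => hij.ne' ?_
    have e1 : (⌊b i - b j⌋ : ℝ) = b i - b j := by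
      have := Int.floor_add_fract (b i - b j); linarith
    have e2 : ⌊b j - b i⌋ = -⌊b i - b j⌋ := by
      rw [Int.floor_eq_iff]; push_cast; constructor <;> linarith
    rw [← h, ← h] at e2
    have e3 : (⌊a j - a i⌋ : ℝ) = -⌊a i - a j⌋ := by exact_mod_cast e2
    have := Int.floor_add_fract (a i - a j)
    have := Int.floor_le (a j - a i)
    have := Int.floor_le (a i - a j)
    linarith
  obtain ⟨η, hη, h0, h1⟩ : ∃ η : ℝ, (∀ i j, (0 < Int.fract (b i - b j) → η ≤ Int.fract (b i - b j))
      ∧ η ≤ 1 - Int.fract (a i - a j)) ∧ 0 < η ∧ η < 1 := by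
    have h1 : ∀ᶠ η : ℝ in nhdsWithin 0 (Set.Ioi 0), ∀ i j,
        (0 < Int.fract (b i - b j) → η ≤ Int.fract (b i - b j)) ∧
          η ≤ 1 - Int.fract (a i - a j) := by
      refine Filter.eventually_all.2 fun i => Filter.eventually_all.2 fun j => ?_
      refine Filter.Eventually.and ?_ ?_
      · by_cases hp : 0 < Int.fract (b i - b j)
        · filter_upwards [Ioo_mem_nhdsGT hp] with η hη _ using hη.2.le
        · exact Filter.Eventually.of_forall fun _ hq => absurd hq hp
      · have : 0 < 1 - Int.fract (a i - a j) := by have := Int.fract_lt_one (a i - a j); linarith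
        filter_upwards [Ioo_mem_nhdsGT this] with η hη using hη.2.le
    exact (h1.and (Ioo_mem_nhdsGT one_pos)).exists
  -- A convex function on `[0, 1]`, of slope `η` at `0` and `1 / η` at `1`.
  set ψ : ℝ → ℝ := fun f => max (η * f) (1 - (1 - f) / η) with hψ
  have hψm : StrictMono ψ := fun x y hxy =>
    max_lt_max (by gcongr) (by gcongr)
  have hψ0 : ψ 0 = 0 := by
    simp only [hψ, mul_zero, sub_zero]
    apply max_eq_left
    rw [sub_nonpos]; exact (one_le_div h0).2 h1.le
  have hψ1 : ψ 1 = 1 := by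
    simp only [hψ, mul_one, sub_self, zero_div, sub_zero]
    exact max_eq_right h1.le
  set φ : ℝ → ℝ := fun u => ⌊u⌋ + ψ (Int.fract u) with hφ
  have hφ1 : ∀ u, φ (u + 1) = φ u + 1 := by
    intro u; simp only [hφ, Int.floor_add_one, Int.fract_add_one]; push_cast; ring
  have hφm : StrictMono φ := by
    intro u v huv
    rcases (Int.floor_mono huv.le).eq_or_lt with he | hl
    · have : Int.fract u < Int.fract v := by simp only [Int.fract, he]; linarith
      simp only [hφ, he]
      have := hψm this
      linarith
    · have hl' : (⌊u⌋ : ℝ) + 1 ≤ ⌊v⌋ := by exact_mod_cast hl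
      have e1 := hψm (Int.fract_lt_one u)
      have e2 := hψm.monotone (Int.fract_nonneg v)
      simp only [hφ]
      linarith
  have hφc : Continuous φ := by
    have hc : Continuous ψ := by fun_prop
    have : φ = fun u => u + (fun x => ψ x - x) (Int.fract u) := by
      funext u; have := Int.floor_add_fract u; simp only [hφ]; linarith
    rw [this]
    refine continuous_id.add
      (ContinuousOn.comp_fract'' (f := fun x => ψ x - x) ?_ ?_ :)
    · exact (hc.sub continuous_id).continuousOn
    · simp [hψ0, hψ1]
  have hφle : ∀ i j, φ (a i - a j) ≤ b i - b j := by
    intro i j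
    simp only [hφ]
    rw [h i j, ← Int.floor_add_fract (b i - b j), Int.floor_add_fract]
    have e := Int.floor_add_fract (b i - b j)
    have : ψ (Int.fract (a i - a j)) ≤ Int.fract (b i - b j) := by
      rcases (Int.fract_nonneg (a i - a j)).eq_or_lt with hz | hp
      · rw [← hz, hψ0]; exact Int.fract_nonneg _
      · have e1 := (hη i j).1 (hfr i j hp)
        refine max_le ?_ ?_
        · have := Int.fract_lt_one (a i - a j)
          nlinarith
        · have := Int.fract_nonneg (b i - b j)
          have : 1 ≤ (1 - Int.fract (a i - a j)) / η := (one_le_div h0).2 (hη i j).2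
          linarith
    linarith
  have hne : (Finset.univ : Finset ι).Nonempty := Finset.univ_nonempty
  set g : ℝ → ℝ := fun t => Finset.univ.sup' hne fun i => b i + φ (t - a i) with hg
  have hgm : StrictMono g := by
    intro u v huv
    refine (Finset.sup'_lt_iff _).2 fun i _ => ?_
    refine lt_of_lt_of_le ?_ (Finset.le_sup' (fun i => b i + φ (v - a i)) (Finset.mem_univ i))
    have : φ (u - a i) < φ (v - a i) := hφm (by linarith)
    linarith
  have hgc : Continuous g := by
    refine Continuous.finset_sup'_apply hne fun i _ => ?_
    fun_prop
  have hg1 : ∀ t, g (t + 1) = g t + 1 := by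
    intro t
    apply le_antisymm
    · refine Finset.sup'_le _ _ fun i _ => ?_
      have := Finset.le_sup' (fun i => b i + φ (t - a i)) (Finset.mem_univ i)
      have e : t + 1 - a i = t - a i + 1 := by ring
      rw [e, hφ1]
      simp only [hg]; linarith
    · rw [← le_sub_iff_add_le]
      refine Finset.sup'_le _ _ fun i _ => ?_
      have := Finset.le_sup' (fun i => b i + φ (t + 1 - a i)) (Finset.mem_univ i)
      have e : t + 1 - a i = t - a i + 1 := by ring
      simp only [e, hφ1] at this
      simp only [hg]; linarith
  let f : CircleDeg1Lift := ⟨⟨g, hgm.monotone⟩, hg1⟩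
  have hsurj : Function.Surjective g :=
    hgc.surjective f.tendsto_atTop f.tendsto_atBot
  refine ⟨hgm.orderIsoOfSurjective g hsurj, hg1, fun i => ?_⟩
  change g (a i) = b i
  apply le_antisymm
  · refine Finset.sup'_le _ _ fun j _ => ?_
    have := hφle i j; linarith
  · have := Finset.le_sup' (fun j => b j + φ (a i - a j)) (Finset.mem_univ i)
    have e : φ 0 = 0 := by simp [hφ, hψ0]
    simp only [sub_self, e, add_zero] at this
    exact this

/-! ### Regions for a fixed parameter valuation -/

section Regions

variable {L X P A : Type*}

/-- `v` and `w` have the same parameters and lie in the same clock region over the clocks `Y`,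
for guards whose constants are multiples of `1 / D` and at most `D`. With the present as time `0`,
`-v.clock x` is the time of the last reset of `x`; the regions agree if a reparametrization of time
that fixes the present and commutes with translation by `1 / D` carries the reset times in `v` to
those in `w`, up to clocks beyond `D` in both. -/
def GameVal.SameRegion (D : ℕ) (Y : Set X) (v w : GameVal X P) : Prop :=
  v.param = w.param ∧ ∃ g : ℝ ≃o ℝ, g 0 = 0 ∧ (∀ t, g (t + 1 / D) = g t + 1 / D) ∧
    ∀ x ∈ Y, g (-v.clock x) = -w.clock x ∨ ((D : ℝ) < v.clock x ∧ (D : ℝ) < w.clock x)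

theorem GameVal.SameRegion.symm {D : ℕ} {Y : Set X} {v w : GameVal X P}
    (h : v.SameRegion D Y w) : w.SameRegion D Y v := by
  obtain ⟨hp, g, h0, h1, hg⟩ := h
  refine ⟨hp.symm, g.symm, by rw [g.symm_apply_eq, h0], fun t => ?_, fun x hx => ?_⟩
  · rw [g.symm_apply_eq, h1, g.apply_symm_apply]
  · rcases hg x hx with h | h
    · exact .inl (by rw [g.symm_apply_eq, h])
    · exact .inr h.symm

theorem GameVal.SameRegion.reset {D : ℕ} {Y : Set X} {v w : GameVal X P}
    (h : v.SameRegion D Y w) (Z : Set X) : (v.reset Z).SameRegion D Y (w.reset Z) := by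
  obtain ⟨hp, g, h0, h1, hg⟩ := h
  refine ⟨hp, g, h0, h1, fun x hx => ?_⟩
  by_cases hz : x ∈ Z
  · left; simp [GameVal.reset, hz, h0]
  · simpa [GameVal.reset, hz] using hg x hx

/-- Time successors of valuations in the same region can be matched, in a way that is monotone
in the delay; hence the intermediate valuations are matched as well. -/
theorem GameVal.SameRegion.delay {D : ℕ} {Y : Set X} {v w : GameVal X P}
    (h : v.SameRegion D Y w) (δ : ℝ≥0) :
    ∃ δ' : ℝ≥0, (v.delay δ).SameRegion D Y (w.delay δ') ∧
      ∀ e' ≤ δ', ∃ e ≤ δ, (v.delay e).SameRegion D Y (w.delay e') := by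
  obtain ⟨hp, g, h0, h1, hg⟩ := h
  have key : ∀ e e' : ℝ≥0, g e = e' → (v.delay e).SameRegion D Y (w.delay e') := by
    intro e e' he
    refine ⟨hp, ((OrderIso.addRight (e : ℝ)).trans g).trans (OrderIso.addRight (-(e' : ℝ))),
      ?_, fun t => ?_, fun x hx => ?_⟩
    · simp [he]
    · simp only [OrderIso.trans_apply, OrderIso.addRight_apply]
      rw [show t + 1 / (D : ℝ) + e = t + e + 1 / D by ring, h1]; ring
    · simp only [OrderIso.trans_apply, OrderIso.addRight_apply, GameVal.delay, NNReal.coe_add]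
      rcases hg x hx with h | h
      · left
        rw [show -((v.clock x : ℝ) + e) + e = -v.clock x by ring, h]; ring
      · right
        have := e.coe_nonneg
        have := e'.coe_nonneg
        constructor <;> linarith [h.1, h.2]
  have hpos : 0 ≤ g δ := by rw [← h0]; exact g.monotone δ.coe_nonneg
  refine ⟨(g δ).toNNReal, key _ _ (Real.coe_toNNReal _ hpos).symm, fun e' he' => ?_⟩
  have hs : 0 ≤ g.symm e' := by
    rw [← g.symm_apply_eq.2 h0.symm]; exact g.symm.monotone e'.coe_nonneg
  refine ⟨(g.symm e').toNNReal, ?_, key _ _ ?_⟩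
  · rw [Real.toNNReal_le_iff_le_coe, ← g.le_iff_le, g.apply_symm_apply]
    rwa [← NNReal.coe_le_coe, Real.coe_toNNReal _ hpos] at he'
  · rw [Real.coe_toNNReal _ hs, g.apply_symm_apply]

/-- At the parameter valuation `p`, the guard only mentions clocks in `Y` and compares them to
multiples of `1 / D` that are at most `D`. -/
def Guard.Tame (p : P → ℚ≥0) (D : ℕ) (Y : Set X) : Guard X P → Prop
  | .top => True
  | .and φ ψ => φ.Tame p D Y ∧ ψ.Tame p D Y
  | .clock x _ a => x ∈ Y ∧ (∃ k : ℤ, a.eval p * D = k) ∧ a.eval p ≤ D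
  | .param _ _ _ => True

theorem Guard.Tame.mono {p : P → ℚ≥0} {D D' : ℕ} {Y Y' : Set X} (hD : D ∣ D') (hD' : 0 < D')
    (hY : Y ⊆ Y') {φ : Guard X P} (h : φ.Tame p D Y) : φ.Tame p D' Y' := by
  induction φ with
  | top => trivial
  | and φ ψ ihφ ihψ => exact ⟨ihφ h.1, ihψ h.2⟩
  | param => trivial
  | clock x c a =>
    obtain ⟨hx, ⟨k, hk⟩, hle⟩ := h
    have hDD : (D : ℚ) ≤ D' := by exact_mod_cast Nat.le_of_dvd hD' hD
    obtain ⟨m, rfl⟩ := hD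
    refine ⟨hY hx, ⟨k * m, ?_⟩, hle.trans hDD⟩
    push_cast
    rw [← mul_assoc, hk]

theorem Guard.exists_tame (p : P → ℚ≥0) (φ : Guard X P) :
    ∃ D : ℕ, 0 < D ∧ ∃ Y : Set X, Y.Finite ∧ φ.Tame p D Y := by
  induction φ with
  | top => exact ⟨1, one_pos, ∅, Set.finite_empty, trivial⟩
  | param => exact ⟨1, one_pos, ∅, Set.finite_empty, trivial⟩
  | and φ ψ ihφ ihψ =>
    obtain ⟨D, hD, Y, hY, h⟩ := ihφ
    obtain ⟨D', hD', Y', hY', h'⟩ := ihψ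
    have hpos := Nat.mul_pos hD hD'
    exact ⟨D * D', hpos, Y ∪ Y', hY.union hY', h.mono (Dvd.intro _ rfl) hpos Set.subset_union_left,
      h'.mono (Dvd.intro_left _ rfl) hpos Set.subset_union_right⟩
  | clock x c a =>
    -- The denominator makes the constant a multiple of `1 / D`; the other factor bounds it by `D`.
    set q := a.eval p
    have hd : (1 : ℚ) ≤ q.den := by exact_mod_cast q.pos
    refine ⟨q.den * (⌈q⌉₊ + 1), Nat.mul_pos q.pos (Nat.succ_pos _), {x}, Set.finite_singleton x,
      rfl, ⟨q.num * (⌈q⌉₊ + 1), ?_⟩, ?_⟩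
    · push_cast
      rw [← mul_assoc, Rat.mul_den_eq_num]
    · have h1 := Nat.le_ceil q
      push_cast
      have : (0 : ℚ) ≤ ⌈q⌉₊ := by positivity
      change q ≤ _
      nlinarith

theorem Guard.exists_tame_of_finite (p : P → ℚ≥0) {Γ : Set (Guard X P)} (hΓ : Γ.Finite) :
    ∃ D : ℕ, 0 < D ∧ ∃ Y : Set X, Y.Finite ∧ ∀ φ ∈ Γ, φ.Tame p D Y := by
  induction Γ, hΓ using Set.Finite.induction_on with
  | empty => exact ⟨1, one_pos, ∅, Set.finite_empty, by simp⟩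
  | @insert φ Γ _ _ ih =>
    obtain ⟨D, hD, Y, hY, h⟩ := φ.exists_tame p
    obtain ⟨D', hD', Y', hY', h'⟩ := ih
    have hpos := Nat.mul_pos hD hD'
    refine ⟨D * D', hpos, Y ∪ Y', hY.union hY', Set.forall_mem_insert.2 ⟨?_, fun ψ hψ => ?_⟩⟩
    · exact h.mono (Dvd.intro _ rfl) hpos Set.subset_union_left
    · exact (h' ψ hψ).mono (Dvd.intro_left _ rfl) hpos Set.subset_union_right

theorem Cmp.holds_congr (c : Cmp) {a b q : ℝ} (h1 : a < q ↔ b < q) (h2 : q < a ↔ q < b) :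
    c.holds a q ↔ c.holds b q := by
  cases c
  · exact h1
  · exact not_lt.symm.trans ((not_congr h2).trans not_lt)
  · change a = q ↔ b = q
    rw [le_antisymm_iff, le_antisymm_iff, ← not_lt, ← not_lt, ← not_lt, ← not_lt, h1, h2]
  · exact not_lt.symm.trans ((not_congr h1).trans not_lt)
  · exact h2

theorem GameVal.SameRegion.sat_iff {D : ℕ} (hD : 0 < D) {Y : Set X} {v w : GameVal X P}
    (h : v.SameRegion D Y w) {φ : Guard X P} (hφ : φ.Tame v.param D Y) : φ.sat v ↔ φ.sat w := by
  induction φ with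
  | top => exact Iff.rfl
  | and φ ψ ihφ ihψ => exact and_congr (ihφ hφ.1) (ihψ hφ.2)
  | param a c b => simp only [Guard.sat, h.1]
  | clock x c a =>
    obtain ⟨hp, g, h0, h1, hg⟩ := h
    obtain ⟨hx, ⟨k, hk⟩, hle⟩ := hφ
    simp only [Guard.sat, ← hp]
    set q := a.eval v.param
    have hle' : (q : ℝ) ≤ D := by exact_mod_cast hle
    rcases hg x hx with hgx | ⟨hv, hw⟩
    · have hD' : (D : ℝ) ≠ 0 := by positivity
      have hk' : -(q : ℝ) = ((-k : ℤ) : ℝ) * (1 / D) := by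
        have : (q : ℝ) * D = k := by exact_mod_cast hk
        field_simp
        push_cast
        linarith
      have hper : Function.Periodic (fun t => g t - t) (1 / (D : ℝ)) := fun t => by
        simp only [h1]; ring
      have hq : g (-q) = -q := by
        have := hper.int_mul (-k) 0
        simp only [zero_add, h0, sub_zero] at this
        rw [← hk'] at this
        linarith
      apply Cmp.holds_congr
      · rw [← neg_lt_neg_iff, ← g.lt_iff_lt, hq, hgx, neg_lt_neg_iff]
      · rw [← neg_lt_neg_iff, ← g.lt_iff_lt, hq, hgx, neg_lt_neg_iff]
    · apply Cmp.holds_congr <;> constructor <;> intro <;> linarith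

/-- The times of the last resets of the clocks in `Y`, cut off at `-(D + 1)`, and the present. -/
noncomputable def GameVal.resetTime (D : ℕ) (Y : Set X) (v : GameVal X P) : Option Y → ℝ
  | none => 0
  | some x => -min (v.clock x : ℝ) (D + 1)

/-- The pairwise differences of the (cut off) reset times, rounded down to multiples of `1 / D`.
They determine the region. -/
noncomputable def GameVal.regionCode (D : ℕ) (Y : Set X) (v : GameVal X P)
    (ij : Option Y × Option Y) : ℤ :=
  ⌊v.resetTime D Y ij.1 * D - v.resetTime D Y ij.2 * D⌋

theorem GameVal.finite_range_regionCode (D : ℕ) {Y : Set X} (hY : Y.Finite) :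
    (Set.range (GameVal.regionCode (P := P) D Y)).Finite := by
  have := hY.to_subtype
  refine (Set.Finite.pi' (t := fun _ : Option Y × Option Y =>
    Set.Icc (-((D + 1) * D : ℤ)) ((D + 1) * D)) fun _ => Set.finite_Icc _ _).subset ?_
  rintro _ ⟨v, rfl⟩ ⟨i, j⟩
  have hb : ∀ i, -(D + 1 : ℝ) ≤ v.resetTime D Y i ∧ v.resetTime D Y i ≤ 0 := by
    rintro (_ | x)
    · simp only [resetTime]; constructor
      · have : (0 : ℝ) ≤ D := by positivity
        linarith
      · exact le_rfl
    · simp only [resetTime]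
      have : (0 : ℝ) ≤ min (v.clock x : ℝ) (D + 1) := by positivity
      exact ⟨neg_le_neg (min_le_right _ _), by linarith⟩
  have hD : (0 : ℝ) ≤ D := by positivity
  have h1 := mul_le_mul_of_nonneg_right (hb i).1 hD
  have h2 := mul_le_mul_of_nonneg_right (hb i).2 hD
  have h3 := mul_le_mul_of_nonneg_right (hb j).1 hD
  have h4 := mul_le_mul_of_nonneg_right (hb j).2 hD
  constructor
  · rw [GameVal.regionCode, Int.le_floor]; push_cast; linarith
  · rw [GameVal.regionCode]
    have : (⌊v.resetTime D Y i * D - v.resetTime D Y j * D⌋ : ℝ) ≤ ((D + 1) * D : ℤ) := by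
      refine (Int.floor_le _).trans ?_
      push_cast; linarith
    exact_mod_cast this

theorem GameVal.sameRegion_of_regionCode_eq {D : ℕ} (hD : 0 < D) {Y : Set X} (hY : Y.Finite)
    {v w : GameVal X P} (hp : v.param = w.param)
    (h : v.regionCode D Y = w.regionCode D Y) : v.SameRegion D Y w := by
  have := hY.to_subtype
  have hD' : (0 : ℝ) < D := by positivity
  obtain ⟨g, hg1, hg⟩ := exists_orderIso_of_floor_sub_eq (fun i => v.resetTime D Y i * D)
    (fun i => w.resetTime D Y i * D) fun i j => congrFun h (i, j)
  refine ⟨hp, ((OrderIso.mulRight₀ (D : ℝ) hD').trans g).trans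
      (OrderIso.mulRight₀ (D : ℝ)⁻¹ (inv_pos.2 hD')),
    ?_, fun t => ?_, fun x hx => ?_⟩
  · have := hg none
    simp only [resetTime, zero_mul] at this
    simp [this]
  · simp only [OrderIso.trans_apply, OrderIso.mulRight₀_apply, add_mul]
    rw [one_div_mul_cancel hD'.ne', hg1, add_mul, one_mul, one_div]
  · have h1 := hg (some ⟨x, hx⟩)
    have hlt : ∀ u : GameVal X P, (D : ℝ) < u.clock x ↔
        u.regionCode D Y (some ⟨x, hx⟩, none) < -(D * D : ℤ) := by
      intro u
      rw [GameVal.regionCode, Int.floor_lt]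
      simp only [resetTime]
      push_cast
      rw [zero_mul, sub_zero, neg_mul, neg_lt_neg_iff, mul_lt_mul_iff_left₀ hD', lt_min_iff]
      simp
    by_cases hv : (D : ℝ) < v.clock x
    · exact .inr ⟨hv, (hlt w).2 (by rw [← h]; exact (hlt v).1 hv)⟩
    · have hw : ¬ (D : ℝ) < w.clock x := by rw [hlt w, ← h, ← hlt v]; exact hv
      left
      have ev : min (v.clock x : ℝ) (D + 1) = v.clock x := min_eq_left (by linarith)
      have ew : min (w.clock x : ℝ) (D + 1) = w.clock x := min_eq_left (by linarith)
      simp only [resetTime, ev, ew] at h1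
      simp only [OrderIso.trans_apply, OrderIso.mulRight₀_apply, h1]
      exact mul_inv_cancel_right₀ hD'.ne' _

end Regions

/-- An increasing sequence of subsets of `S`, each a union of fibres in `S` of a map with finite
image, is eventually constant. -/
theorem exists_forall_subset_of_finite_image {α β : Type*} (code : α → β) {S : Set α}
    (hfin : (code '' S).Finite) (W : ℕ → Set α) (hmono : Monotone W) (hS : ∀ n, W n ⊆ S)
    (hinv : ∀ n, ∀ a ∈ W n, ∀ b ∈ S, code a = code b → b ∈ W n) : ∃ N, ∀ m, W m ⊆ W N := by
  classical
  have hex : ∀ d : β, ∃ n, ∀ m, ∀ a ∈ W m, code a = d → ∃ b ∈ W n, code b = d := by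
    intro d
    by_cases h : ∃ n, ∃ b ∈ W n, code b = d
    · obtain ⟨n, hn⟩ := h
      exact ⟨n, fun _ _ _ _ => hn⟩
    · exact ⟨0, fun m a ha had => absurd ⟨m, a, ha, had⟩ h⟩
  choose f hf using hex
  obtain ⟨N, hN⟩ := (hfin.image f).bddAbove
  refine ⟨N, fun m a ha => ?_⟩
  obtain ⟨b, hb, hba⟩ := hf (code a) m a ha rfl
  exact hmono (hN ⟨_, ⟨a, hS m ha, rfl⟩, rfl⟩) (hinv _ b hb a (hS m ha) hba)

namespace PTG

variable {L X P A : Type*} {G : PTG L X P A} {R : Set L}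

/-! ### Timed and discrete steps -/

theorem timed_zero {s : State L X P} (hs : s ∈ G.stateSpace) : G.Timed 0 s s :=
  ⟨hs, hs, rfl, by simp [GameVal.delay]⟩

theorem Timed.trans {δ δ' : ℝ≥0} {s s' s'' : State L X P} (h : G.Timed δ s s')
    (h' : G.Timed δ' s' s'') : G.Timed (δ + δ') s s'' :=
  ⟨h.1, h'.2.1, h'.2.2.1.trans h.2.2.1, by
    rw [h'.2.2.2, h.2.2.2]; simp [GameVal.delay, add_assoc]⟩

theorem Timed.param_eq {δ : ℝ≥0} {s s' : State L X P} (h : G.Timed δ s s') :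
    s'.val.param = s.val.param := by rw [h.2.2.2]; rfl

theorem Disc.param_eq {t : Transition L X P A} {s s' : State L X P} (h : G.Disc t s s') :
    s'.val.param = s.val.param := by rw [h.2.2.2.2.2]; rfl

/-- Symbolic states that are closed under delays, in a location that is initial or the target of a
transition; the algorithm only handles such symbolic states. -/
structure IsNode (G : PTG L X P A) (ξ : G.SymState) : Prop where
  closed : ∀ s ∈ ξ.states, ∀ δ s', G.Timed δ s s' → s' ∈ ξ.states
  loc_mem : ξ.loc ∈ insert G.init (Transition.target '' (G.ctrl ∪ G.unctrl))

theorem mem_stateSpace_of_mem_states {ξ : G.SymState} {s : State L X P} (h : s ∈ ξ.states) :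
    s ∈ G.stateSpace := by
  have := ξ.sub _ h.2
  rw [← h.1] at this
  exact this

theorem subset_tempSucc (ξ : G.SymState) : ξ.states ⊆ (G.tempSucc ξ).states := fun s h => by
  refine ⟨h.1, s, h, 0, ?_⟩
  rw [← h.1]
  exact timed_zero (mem_stateSpace_of_mem_states h)

theorem tempSucc_closed (ξ : G.SymState) (s) (hs : s ∈ (G.tempSucc ξ).states) (δ : ℝ≥0)
    (s' : State L X P) (h : G.Timed δ s s') : s' ∈ (G.tempSucc ξ).states := by
  obtain ⟨hl, s₀, hs₀, δ₀, h₀⟩ := hs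
  refine ⟨h.2.2.1.trans hl, s₀, hs₀, δ₀ + δ, Timed.trans h₀ ?_⟩
  have e : ∀ u : State L X P, u.loc = ξ.loc → (⟨ξ.loc, u.val⟩ : State L X P) = u :=
    fun u hu => State.ext hu.symm rfl
  rw [e s hl, e s' (h.2.2.1.trans hl)]
  exact h

theorem isNode_init : G.IsNode (G.tempSucc G.symInit) :=
  ⟨tempSucc_closed _, Set.mem_insert _ _⟩

theorem isNode_of_isSucc {ξ ξ' : G.SymState} (h : G.IsSucc ξ ξ') : G.IsNode ξ' := by
  obtain ⟨t, ht, -, rfl⟩ := h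
  exact ⟨tempSucc_closed _, Set.mem_insert_of_mem _ ⟨t, ht, rfl⟩⟩

theorem mem_post {ξ : G.SymState} {t : Transition L X P A} {s s' : State L X P}
    (hs : s ∈ ξ.states) (h : G.Disc t s s') : s' ∈ (G.post t ξ).states := by
  refine subset_tempSucc _ ⟨h.2.2.2.1, s, hs, ?_⟩
  rw [← h.2.2.2.1]
  exact h

theorem mem_init_of_mem_initStates {s : State L X P} (h : s ∈ G.initStates) :
    s ∈ (G.tempSucc G.symInit).states := by
  refine subset_tempSucc _ ⟨h.2.1, ?_, h.2.2⟩
  have := h.1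
  rw [stateSpace, Set.mem_ofPred_eq, h.2.1] at this
  exact this

/-! ### Invariants of the algorithm -/

/-- The invariants of the main loop. -/
structure AlgState.Consistent (R : Set L) (c : G.AlgState) : Prop where
  node_waiting : ∀ ξ ∈ c.waitingExplore, G.IsNode ξ
  node_explored : ∀ ξ ∈ c.explored, G.IsNode ξ
  update_subset : c.waitingUpdate ⊆ c.explored
  win_subset : ∀ ξ, c.win ξ ⊆ ξ.states
  depends_subset : ∀ ξ, c.depends ξ ⊆ c.explored
  mem_depends : ∀ ξ ∈ c.explored, ∀ ξ', G.IsSucc ξ ξ' → ξ ∈ c.depends ξ'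
  win_target : ∀ ξ ∈ c.explored, ξ.loc ∈ R → c.win ξ = ξ.states
  succ_mem : ∀ ξ ∈ c.explored, ∀ ξ', G.IsSucc ξ ξ' → ξ' ∈ c.explored ∪ c.waitingExplore

theorem consistent_algInit : G.algInit.Consistent R where
  node_waiting := by rintro ξ rfl; exact isNode_init
  node_explored _ h := h.elim
  update_subset _ h := h
  win_subset _ _ h := h.elim
  depends_subset _ _ h := h
  mem_depends _ h := h.elim
  win_target _ h := h.elim
  succ_mem _ h := h.elim

theorem newWin_subset (ξ : G.SymState) (c : G.AlgState) : G.newWin ξ c ⊆ ξ.states :=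
  Set.inter_subset_right

theorem updateWin_self (ξ : G.SymState) (c : G.AlgState) :
    G.updateWin ξ c ξ = c.win ξ ∪ G.newWin ξ c := by
  unfold updateWin
  split_ifs with h
  · exact (Set.union_eq_left.2 h).symm
  · simp

theorem updateWin_of_ne {ξ η : G.SymState} (h : η ≠ ξ) (c : G.AlgState) :
    G.updateWin ξ c η = c.win η := by
  unfold updateWin
  split_ifs
  · rfl
  · simp [h]

theorem exploreWin_self {ξ : G.SymState} (h : ξ.loc ∈ R) (c : G.AlgState) :
    (G.explore R ξ c).win ξ = ξ.states := by
  simp [explore, h]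

theorem exploreWin_of_not_mem {ξ : G.SymState} (h : ξ.loc ∉ R) (c : G.AlgState) :
    (G.explore R ξ c).win = c.win := by
  simp [explore, h]

theorem exploreWin_of_ne {ξ η : G.SymState} (h : η ≠ ξ) (c : G.AlgState) :
    (G.explore R ξ c).win η = c.win η := by
  by_cases hR : ξ.loc ∈ R <;> simp [explore, h, hR]

theorem win_subset_explore {c : G.AlgState} (hc : c.Consistent R) (ξ η : G.SymState) :
    c.win η ⊆ (G.explore R ξ c).win η := by
  by_cases hne : η = ξ
  · subst hne
    by_cases hR : η.loc ∈ R
    · rw [exploreWin_self hR]; exact hc.win_subset η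
    · rw [exploreWin_of_not_mem hR]
  · rw [exploreWin_of_ne hne]

theorem win_subset_updateWin (c : G.AlgState) (ξ η : G.SymState) :
    c.win η ⊆ G.updateWin ξ c η := by
  by_cases hne : η = ξ
  · subst hne; rw [updateWin_self]; exact Set.subset_union_left
  · rw [updateWin_of_ne hne]

theorem exploreDepends_subset {c : G.AlgState} (hc : c.Consistent R) (ξ ξ' : G.SymState) :
    G.exploreDepends ξ c ξ' ⊆ c.explored ∪ {ξ} :=
  Set.union_subset_union (hc.depends_subset ξ') fun _ h => h.1

theorem AlgState.Consistent.explore {c : G.AlgState} (hc : c.Consistent R) {ξ : G.SymState}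
    (hξ : ξ ∈ c.waitingExplore) : (G.explore R ξ c).Consistent R where
  node_waiting := by
    rintro η (h | h)
    · exact hc.node_waiting η h.1
    · exact isNode_of_isSucc h.1
  node_explored := by
    rintro η (h | rfl)
    · exact hc.node_explored η h
    · exact hc.node_waiting η hξ
  update_subset := by
    rintro η (h | h)
    · by_cases hR : ξ.loc ∈ R
      · rw [if_pos hR] at h
        rcases h with h | h
        · exact .inl (hc.update_subset h)
        · exact exploreDepends_subset hc ξ ξ h
      · rw [if_neg hR] at h
        exact .inl (hc.update_subset h)
    · exact .inr h
  win_subset η := by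
    by_cases hne : η = ξ
    · subst hne
      by_cases hR : η.loc ∈ R
      · rw [exploreWin_self hR]
      · rw [exploreWin_of_not_mem hR]; exact hc.win_subset η
    · rw [exploreWin_of_ne hne]; exact hc.win_subset η
  depends_subset η := exploreDepends_subset hc ξ η
  mem_depends := by
    rintro η (h | rfl) ξ' hs
    · exact .inl (hc.mem_depends η h ξ' hs)
    · exact .inr ⟨rfl, hs⟩
  win_target := by
    rintro η h hR
    by_cases hne : η = ξ
    · subst hne; exact exploreWin_self hR c
    · rw [exploreWin_of_ne hne]
      exact hc.win_target η (h.resolve_right hne) hR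
  succ_mem := by
    intro η h ξ' hs
    by_cases he : ξ' ∈ c.explored
    · exact .inl (.inl he)
    rcases h with h | rfl
    · by_cases hne : ξ' = ξ
      · exact .inl (.inr hne)
      · exact .inr (.inl ⟨(hc.succ_mem η h ξ' hs).resolve_left he, hne⟩)
    · exact .inr (.inr ⟨hs, he⟩)

theorem AlgState.Consistent.update {c : G.AlgState} (hc : c.Consistent R) {ξ : G.SymState}
    (hξ : ξ ∈ c.waitingUpdate) : (G.update ξ c).Consistent R where
  node_waiting := hc.node_waiting
  node_explored := hc.node_explored
  update_subset := by
    intro η h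
    simp only [PTG.update] at h
    split_ifs at h
    · exact hc.update_subset h.1
    · exact h.elim (fun h => hc.update_subset h.1) fun h => hc.depends_subset ξ h
  win_subset η := by
    change G.updateWin ξ c η ⊆ _
    by_cases hne : η = ξ
    · subst hne
      rw [updateWin_self]
      exact Set.union_subset (hc.win_subset η) (newWin_subset η c)
    · rw [updateWin_of_ne hne]; exact hc.win_subset η
  depends_subset := hc.depends_subset
  mem_depends := hc.mem_depends
  win_target := by
    intro η h hR
    change G.updateWin ξ c η = _
    have h1 := hc.win_target η h hR
    by_cases hne : η = ξ
    · subst hne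
      rw [updateWin_self, h1]
      exact Set.union_eq_left.2 (newWin_subset η c)
    · rw [updateWin_of_ne hne, h1]
  succ_mem := hc.succ_mem

theorem AlgStep.of_explore {c c' : G.AlgState} {ξ : G.SymState}
    (h : G.AlgStep R c (some (.explore ξ)) c') : ξ ∈ c.waitingExplore ∧ c' = G.explore R ξ c := by
  cases h with
  | explore _ h => exact ⟨h, rfl⟩

theorem AlgStep.of_update {c c' : G.AlgState} {ξ : G.SymState}
    (h : G.AlgStep R c (some (.update ξ)) c') : ξ ∈ c.waitingUpdate ∧ c' = G.update ξ c := by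
  cases h with
  | update _ h => exact ⟨h, rfl⟩

theorem AlgStep.consistent {c c' : G.AlgState} {a} (h : G.AlgStep R c a c')
    (hc : c.Consistent R) : c'.Consistent R := by
  cases h with
  | explore ξ h => exact hc.explore h
  | update ξ h => exact hc.update h
  | done => exact hc

theorem AlgStep.win_subset {c c' : G.AlgState} {a} (h : G.AlgStep R c a c')
    (hc : c.Consistent R) (η : G.SymState) : c.win η ⊆ c'.win η := by
  cases h with
  | explore ξ h => exact win_subset_explore hc ξ η
  | update ξ h => exact win_subset_updateWin c ξ η
  | done => exact subset_rfl

theorem AlgStep.explored_subset {c c' : G.AlgState} {a} (h : G.AlgStep R c a c') :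
    c.explored ⊆ c'.explored := by
  cases h with
  | explore ξ h => exact Set.subset_union_left
  | update ξ h => exact subset_rfl
  | done => exact subset_rfl

/-- When `Win[ξ']` changes, the explored symbolic states with successor `ξ'` become due for an
update. -/
theorem AlgStep.mem_waitingUpdate {c c' : G.AlgState} {a} (h : G.AlgStep R c a c')
    (hc : c.Consistent R) {ξ ξ' : G.SymState} (hξ : ξ ∈ c.explored) (hs : G.IsSucc ξ ξ')
    (hne : ¬ c'.win ξ' ⊆ c.win ξ') : ξ ∈ c'.waitingUpdate := by
  have hd := hc.mem_depends ξ hξ ξ' hs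
  cases h with
  | explore η h =>
    by_cases hR : η.loc ∈ R
    · have : ξ' = η := by
        by_contra hn
        rw [exploreWin_of_ne hn] at hne
        exact hne subset_rfl
      subst this
      refine .inl ?_
      rw [if_pos hR]
      exact .inr (.inl hd)
    · rw [exploreWin_of_not_mem hR] at hne
      exact absurd subset_rfl hne
  | update η h =>
    change ¬ G.updateWin η c ξ' ⊆ _ at hne
    have : ξ' = η := by
      by_contra hn
      rw [updateWin_of_ne hn] at hne
      exact hne subset_rfl
    subst this
    rw [updateWin_self] at hne
    have hn : ¬ G.newWin ξ' c ⊆ c.win ξ' := fun h => hne (Set.union_subset subset_rfl h)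
    simp only [PTG.update, if_neg hn]
    exact .inr hd
  | done => exact absurd subset_rfl hne

namespace Execution

variable (E : G.Execution R)

theorem consistent (n : ℕ) : (E.conf n).Consistent R := by
  induction n with
  | zero => rw [E.start]; exact consistent_algInit
  | succ n ih => exact (E.step n).consistent ih

theorem win_mono (ξ : G.SymState) : Monotone fun n => (E.conf n).win ξ :=
  monotone_nat_of_le_succ fun n => (E.step n).win_subset (E.consistent n) ξ

theorem explored_mono : Monotone fun n => (E.conf n).explored :=
  monotone_nat_of_le_succ fun n => (E.step n).explored_subset

variable {E}

theorem exists_explored_of_waiting (hE : E.Fair) {n : ℕ} {ξ : G.SymState}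
    (h : ξ ∈ (E.conf n).waitingExplore) : ∃ m, ξ ∈ (E.conf m).explored := by
  obtain ⟨m, -, hm⟩ := hE.1 n ξ h
  have hs := E.step m
  rw [hm] at hs
  refine ⟨m + 1, ?_⟩
  rw [hs.of_explore.2]
  exact .inr rfl

theorem exists_explored_of_isSucc (hE : E.Fair) {n : ℕ} {ξ ξ' : G.SymState}
    (h : ξ ∈ (E.conf n).explored) (hs : G.IsSucc ξ ξ') : ∃ m, ξ' ∈ (E.conf m).explored :=
  ((E.consistent n).succ_mem ξ h ξ' hs).elim (fun h => ⟨n, h⟩) (exists_explored_of_waiting hE)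

/-- An explored symbolic state is due for an update right after some exploration. -/
theorem exists_explored_waitingUpdate {n : ℕ} {ξ : G.SymState} (h : ξ ∈ (E.conf n).explored) :
    ∃ m, ξ ∈ (E.conf m).explored ∧ ξ ∈ (E.conf m).waitingUpdate := by
  induction n with
  | zero => rw [E.start] at h; exact h.elim
  | succ n ih =>
    by_cases hn : ξ ∈ (E.conf n).explored
    · exact ih hn
    · refine ⟨n + 1, h, ?_⟩
      have hs := E.step n
      generalize E.conf (n + 1) = c', E.act n = a at *
      cases hs with
      | explore η hη => exact .inr (h.resolve_left hn)
      | update η hη => exact absurd h hn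
      | done => exact absurd h hn

end Execution

/-! ### Regions and the winning sets -/

/-- States of the same location with valuations of parameters `p` in the same region. -/
def SameRegion (p : P → ℚ≥0) (D : ℕ) (Y : Set X) (s s' : State L X P) : Prop :=
  s.loc = s'.loc ∧ s.val.param = p ∧ s.val.SameRegion D Y s'.val

theorem SameRegion.symm {p : P → ℚ≥0} {D : ℕ} {Y : Set X} {s s' : State L X P}
    (h : SameRegion p D Y s s') : SameRegion p D Y s' s :=
  ⟨h.1.symm, h.2.2.1.symm.trans h.2.1, h.2.2.symm⟩

/-- At parameters `p`, the guards of all transitions and the invariants of all locations that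
the algorithm meets respect the regions given by `D` and `Y`. -/
structure Tame (G : PTG L X P A) (p : P → ℚ≥0) (D : ℕ) (Y : Set X) : Prop where
  pos : 0 < D
  finite : Y.Finite
  guard : ∀ t ∈ G.ctrl ∪ G.unctrl, t.guard.Tame p D Y
  inv : ∀ l ∈ insert G.init (Transition.target '' (G.ctrl ∪ G.unctrl)), (G.inv l).Tame p D Y

theorem exists_tame (G : PTG L X P A) (p : P → ℚ≥0) : ∃ D Y, G.Tame p D Y := by
  have hT := G.ctrl_finite.union G.unctrl_finite
  obtain ⟨D, hD, Y, hY, h⟩ := Guard.exists_tame_of_finite p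
    ((hT.image Transition.guard).union (((hT.image Transition.target).insert G.init).image G.inv))
  exact ⟨D, Y, hD, hY, fun t ht => h _ (.inl ⟨t, ht, rfl⟩), fun l hl => h _ (.inr ⟨l, hl, rfl⟩)⟩

theorem SameRegion.mem_stateSpace {p : P → ℚ≥0} {D : ℕ} {Y : Set X} (hG : G.Tame p D Y)
    {s s' : State L X P} (h : SameRegion p D Y s s') (hs : s ∈ G.stateSpace)
    (hl : s.loc ∈ insert G.init (Transition.target '' (G.ctrl ∪ G.unctrl))) :
    s' ∈ G.stateSpace := by
  obtain ⟨h1, rfl, h2⟩ := h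
  rw [stateSpace, Set.mem_ofPred_eq, ← h1]
  exact (h2.sat_iff hG.pos (hG.inv _ hl)).1 hs

theorem SameRegion.timed {p : P → ℚ≥0} {D : ℕ} {Y : Set X} (hG : G.Tame p D Y)
    {s s' : State L X P} (h : SameRegion p D Y s s') (hs' : s' ∈ G.stateSpace)
    (hl : s.loc ∈ insert G.init (Transition.target '' (G.ctrl ∪ G.unctrl)))
    {δ : ℝ≥0} {u : State L X P} (hu : G.Timed δ s u) :
    ∃ δ' u', G.Timed δ' s' u' ∧ SameRegion p D Y u u' ∧
      ∀ w' ∈ G.coverStep s' δ', ∃ w ∈ G.coverStep s δ, SameRegion p D Y w w' := by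
  obtain ⟨δ', h1, h2⟩ := h.2.2.delay δ
  have hru : SameRegion p D Y u ⟨s'.loc, s'.val.delay δ'⟩ :=
    ⟨hu.2.2.1.trans h.1, hu.param_eq.trans h.2.1, by rw [hu.2.2.2]; exact h1⟩
  refine ⟨δ', _, ⟨hs', hru.mem_stateSpace hG hu.2.1 ?_, rfl, rfl⟩, hru, ?_⟩
  · rw [hu.2.2.1]; exact hl
  rintro w' ⟨e', he', hw'⟩
  obtain ⟨e, he, h3⟩ := h2 e' he'
  have hrw : SameRegion p D Y ⟨s.loc, s.val.delay e⟩ w' :=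
    ⟨h.1.trans hw'.2.2.1.symm, h.2.1, by rw [hw'.2.2.2]; exact h3⟩
  refine ⟨_, ⟨e, he, hu.1, hrw.symm.mem_stateSpace hG hw'.2.1 ?_, rfl, rfl⟩, hrw⟩
  rw [hw'.2.2.1, ← h.1]; exact hl

theorem SameRegion.disc {p : P → ℚ≥0} {D : ℕ} {Y : Set X} (hG : G.Tame p D Y)
    {s s' : State L X P} (h : SameRegion p D Y s s') (hs' : s' ∈ G.stateSpace)
    {t : Transition L X P A} (ht : t ∈ G.ctrl ∪ G.unctrl) {u : State L X P} (hu : G.Disc t s u) :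
    ∃ u', G.Disc t s' u' ∧ SameRegion p D Y u u' := by
  have hru : SameRegion p D Y u ⟨t.target, s'.val.reset t.resets⟩ :=
    ⟨hu.2.2.2.1, hu.param_eq.trans h.2.1, by rw [hu.2.2.2.2.2]; exact h.2.2.reset _⟩
  refine ⟨_, ⟨hs', hru.mem_stateSpace hG hu.2.1 ?_, h.1.symm.trans hu.2.2.1, rfl, ?_, rfl⟩, hru⟩
  · rw [hu.2.2.2.1]; exact Set.mem_insert_of_mem _ ⟨t, ht, rfl⟩
  · obtain ⟨-, rfl, h2⟩ := h
    exact (h2.sat_iff hG.pos (hG.guard t ht)).1 hu.2.2.2.2.1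

/-- Inside each symbolic state, `c.win` is a union of regions at the parameters `p`. -/
def AlgState.RegionInvariant (c : G.AlgState) (p : P → ℚ≥0) (D : ℕ) (Y : Set X) : Prop :=
  ∀ ξ, ∀ s ∈ c.win ξ, ∀ s' ∈ ξ.states, SameRegion p D Y s s' → s' ∈ c.win ξ

theorem AlgState.RegionInvariant.newWin {c : G.AlgState} {p : P → ℚ≥0}
    {D : ℕ} {Y : Set X} (hG : G.Tame p D Y) (h : c.RegionInvariant p D Y) {ξ : G.SymState}
    (hξ : G.IsNode ξ) {s s' : State L X P} (hs : s ∈ G.newWin ξ c) (hs' : s' ∈ ξ.states)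
    (hr : SameRegion p D Y s s') : s' ∈ G.newWin ξ c := by
  obtain ⟨⟨u, hu, δ, hδ, hcov⟩, hsξ⟩ := hs
  have hl := hξ.loc_mem
  rw [← hsξ.1] at hl
  obtain ⟨δ', u', hδ', hru, hcov'⟩ :=
    hr.timed hG (mem_stateSpace_of_mem_states hs') hl hδ
  have huξ := hξ.closed s hsξ δ u hδ
  have huξ' := hξ.closed s' hs' δ' u' hδ'
  refine ⟨⟨u', ?_, δ', hδ', Set.eq_empty_iff_forall_notMem.2 ?_⟩, hs'⟩
  · rcases hu with hu | ⟨t, ht, htl, w, hw, hd⟩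
    · exact .inl (h ξ u hu u' huξ' hru)
    · obtain ⟨w', hd', hrw⟩ := hru.disc hG (mem_stateSpace_of_mem_states huξ') (.inl ht) hd
      exact .inr ⟨t, ht, htl, w', h _ w hw w' (mem_post huξ' hd') hrw, hd'⟩
  · rintro w' ⟨hw', t, ht, htl, z', ⟨hz', hzw'⟩, hd'⟩
    obtain ⟨w, hw, hrw⟩ := hcov' w' hw'
    obtain ⟨e, he, hew⟩ := hw
    have hwξ := hξ.closed s hsξ e w hew
    obtain ⟨z, hd, hrz⟩ := hrw.symm.disc hG (mem_stateSpace_of_mem_states hwξ) (.inr ht) hd'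
    refine Set.eq_empty_iff_forall_notMem.1 hcov w
      ⟨⟨e, he, hew⟩, t, ht, htl, z, ⟨mem_post hwξ hd, fun hzw => hzw' ?_⟩, hd⟩
    exact h _ z hzw z' hz' hrz.symm

namespace Execution

theorem regionInvariant (E : G.Execution R) {p : P → ℚ≥0} {D : ℕ} {Y : Set X}
    (hG : G.Tame p D Y) (n : ℕ) : (E.conf n).RegionInvariant p D Y := by
  induction n with
  | zero => rw [E.start]; intro ξ s hs; exact hs.elim
  | succ n ih =>
    have hc := E.consistent n
    have hs := E.step n
    generalize E.conf (n + 1) = c', E.conf n = c, E.act n = a at *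
    intro η s hsw s' hsη hr
    cases hs with
    | explore ξ hξ =>
      by_cases hne : η = ξ
      · subst hne
        by_cases hR : η.loc ∈ R
        · rwa [exploreWin_self hR]
        · rw [exploreWin_of_not_mem hR] at hsw ⊢
          exact ih η s hsw s' hsη hr
      · rw [exploreWin_of_ne hne] at hsw ⊢
        exact ih η s hsw s' hsη hr
    | update ξ hξ =>
      change s ∈ G.updateWin ξ c η at hsw
      change s' ∈ G.updateWin ξ c η
      by_cases hne : η = ξ
      · subst hne
        rw [updateWin_self] at hsw ⊢
        exact hsw.imp (fun h => ih η s h s' hsη hr)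
          fun h => ih.newWin hG (hc.node_explored η (hc.update_subset hξ)) h hsη hr
      · rw [updateWin_of_ne hne] at hsw ⊢
        exact ih η s hsw s' hsη hr
    | done => exact ih η s hsw s' hsη hr

/-- For each symbolic state, the winning set restricted to one parameter valuation is eventually
constant, since it is an increasing sequence of unions of finitely many regions. This is where
the rationality of the parameters enters. -/
theorem exists_win_stable (E : G.Execution R) (ξ : G.SymState) (p : P → ℚ≥0) :
    ∃ N, ∀ m, ∀ s ∈ (E.conf m).win ξ, s.val.param = p → s ∈ (E.conf N).win ξ := by
  obtain ⟨D, Y, hG⟩ := G.exists_tame p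
  obtain ⟨N, hN⟩ := exists_forall_subset_of_finite_image
    (S := {s : State L X P | s ∈ ξ.states ∧ s.val.param = p})
    (fun s => s.val.regionCode D Y)
    ((GameVal.finite_range_regionCode (P := P) D hG.finite).subset
      (by rintro _ ⟨s, -, rfl⟩; exact ⟨s.val, rfl⟩))
    (fun n => {s | s ∈ (E.conf n).win ξ ∧ s.val.param = p})
    (fun m n hmn s hs => ⟨E.win_mono ξ hmn hs.1, hs.2⟩)
    (fun n s hs => ⟨(E.consistent n).win_subset ξ hs.1, hs.2⟩)
    (fun n s hs s' hs' he => by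
      have hsξ := (E.consistent n).win_subset ξ hs.1
      refine ⟨E.regionInvariant hG n ξ s hs.1 s' hs'.1 ⟨hsξ.1.trans hs'.1.1.symm, hs.2, ?_⟩, hs'.2⟩
      exact GameVal.sameRegion_of_regionCode_eq hG.pos hG.finite (hs.2.trans hs'.2.symm) he)
  exact ⟨N, fun m s hs hp => (hN m ⟨hs, hp⟩).1⟩

/-- In a fair execution, an explored symbolic state is updated at a time when the winning sets of
all its successors, restricted to one parameter valuation, have reached their final values. -/
theorem exists_update_stable {E : G.Execution R} (hE : E.Fair) {n : ℕ} {ξ : G.SymState}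
    (hξ : ξ ∈ (E.conf n).explored) (p : P → ℚ≥0) :
    ∃ m, E.act m = some (.update ξ) ∧ ∀ ξ', G.IsSucc ξ ξ' → ∀ k, ∀ s ∈ (E.conf k).win ξ',
      s.val.param = p → s ∈ (E.conf m).win ξ' := by
  obtain ⟨n₀, hexp, hupd⟩ := exists_explored_waitingUpdate hξ
  let Stable : ℕ → Prop := fun N => n₀ ≤ N ∧ ∀ ξ', G.IsSucc ξ ξ' → ∀ k, ∀ s ∈ (E.conf k).win ξ',
      s.val.param = p → s ∈ (E.conf N).win ξ'
  have hfin : {ξ' | G.IsSucc ξ ξ'}.Finite := by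
    refine ((G.ctrl_finite.union G.unctrl_finite).image fun t => G.post t ξ).subset ?_
    rintro _ ⟨t, ht, -, rfl⟩
    exact ⟨t, ht, rfl⟩
  have hex : ∃ N, Stable N := by
    choose f hf using fun ξ' => E.exists_win_stable ξ' p
    obtain ⟨N, hN⟩ := (hfin.image f).bddAbove
    refine ⟨max n₀ N, le_max_left _ _, fun ξ' hs k s hsk hp => ?_⟩
    exact E.win_mono ξ' ((hN ⟨ξ', hs, rfl⟩).trans (le_max_right _ _)) (hf ξ' k s hsk hp)
  -- At the least stable time, either `ξ` has just been explored or the winning set of one of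
  -- its successors has just changed; in both cases `ξ` is due for an update.
  obtain ⟨N, ⟨hN₀, hN⟩, hmin⟩ : ∃ N, Stable N ∧ ∀ M < N, ¬ Stable M := by
    classical exact ⟨Nat.find hex, Nat.find_spec hex, fun _ => Nat.find_min hex⟩
  have hw : ξ ∈ (E.conf N).waitingUpdate := by
    rcases hN₀.eq_or_lt with rfl | hlt
    · exact hupd
    obtain ⟨M, rfl⟩ : ∃ M, N = M + 1 := ⟨N - 1, by omega⟩
    by_contra hnot
    refine hmin M (Nat.lt_succ_self M) ⟨Nat.le_of_lt_succ hlt, fun ξ' hs k s hsk hp => ?_⟩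
    by_contra hsM
    refine hnot ((E.step M).mem_waitingUpdate (E.consistent M)
      (E.explored_mono (Nat.le_of_lt_succ hlt) hexp) hs fun hsub => hsM ?_)
    exact hsub (hN ξ' hs k s hsk hp)
  obtain ⟨m, hm, hact⟩ := hE.2 N ξ hw
  exact ⟨m, hact, fun ξ' hs k s hsk hp => E.win_mono ξ' hm (hN ξ' hs k s hsk hp)⟩

end Execution

end PTG

theorem Guard.sat_delay_of_le {X P : Type*} {φ : Guard X P} {v : GameVal X P} {e δ : ℝ≥0}
    (he : e ≤ δ) (h0 : φ.sat v) (h1 : φ.sat (v.delay δ)) : φ.sat (v.delay e) := by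
  induction φ with
  | top => trivial
  | param => exact h0
  | and φ ψ ihφ ihψ => exact ⟨ihφ h0.1 h1.1, ihψ h0.2 h1.2⟩
  | clock x c a =>
    have he' : (e : ℝ) ≤ δ := he
    have := e.coe_nonneg
    cases c <;> simp only [Guard.sat, Cmp.holds, GameVal.delay, NNReal.coe_add] at h0 h1 ⊢ <;>
      linarith

namespace PTG

variable {L X P A : Type*} {G : PTG L X P A} {R : Set L}

theorem Timed.of_le {e δ : ℝ≥0} {s s' : State L X P} (h : G.Timed δ s s') (he : e ≤ δ) :
    G.Timed e s ⟨s.loc, s.val.delay e⟩ := by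
  refine ⟨h.1, Guard.sat_delay_of_le he h.1 ?_, rfl, rfl⟩
  have := h.2.1
  rwa [stateSpace, Set.mem_ofPred_eq, h.2.2.1, h.2.2.2] at this

theorem Timed.unique {δ : ℝ≥0} {s s₁ s₂ : State L X P} (h₁ : G.Timed δ s s₁)
    (h₂ : G.Timed δ s s₂) : s₁ = s₂ :=
  State.ext (h₁.2.2.1.trans h₂.2.2.1.symm) (h₁.2.2.2.trans h₂.2.2.2.symm)

theorem Disc.eq_fire {t : Transition L X P A} {s s' : State L X P} (h : G.Disc t s s') :
    s' = t.fire s :=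
  State.ext h.2.2.2.1 h.2.2.2.2.2

theorem IsHistory.last_mem {h : History L X P} (hh : G.IsHistory h) : h.last ∈ G.stateSpace := by
  cases hh with
  | start s hs => exact hs
  | timed h δ s _ _ ht => exact ht.2.1
  | disc h t s _ _ _ ht => exact ht.2.1

theorem IsStrategy.disc {T : Set (Transition L X P A)} {σ : History L X P → Move L X P A}
    (hσ : G.IsStrategy T σ) {h : History L X P} (hh : G.IsHistory h) {t : Transition L X P A}
    (ht : σ h = .act t) : t ∈ T ∧ G.Disc t h.last (t.fire h.last) :=
  have ⟨h1, h2, h3, h4⟩ := hσ.avail h hh t ht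
  ⟨h1, hh.last_mem, h4, h2, rfl, h3, rfl⟩

theorem Disc.available {t : Transition L X P A} {s s' : State L X P} (h : G.Disc t s s') :
    s.loc = t.source ∧ t.guard.sat s.val ∧ (G.inv t.target).sat (s.val.reset t.resets) := by
  refine ⟨h.2.2.1, h.2.2.2.2.1, ?_⟩
  have := h.2.1
  rwa [stateSpace, Set.mem_ofPred_eq, h.2.2.2.1, h.2.2.2.2.2] at this

theorem _root_.History.index_extend (h : History L X P) (s : State L X P) :
    (h.extend s).index = h.index + 1 := by
  simp [History.extend, History.index]

/-! ### Steps of a play -/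

section Play

variable {σ : History L X P → Move L X P A} {h : History L X P}

theorem nextPlay_pending (t : Transition L X P A) :
    G.nextPlay σ ⟨h, some t⟩ = some ⟨h.extend (t.fire h.last), none⟩ := rfl

theorem nextPlay_even_act (he : Even h.index) {t : Transition L X P A} (ht : σ h = .act t) :
    G.nextPlay σ ⟨h, none⟩ = some ⟨h.extend h.last, some t⟩ := by
  simp [nextPlay, he, ht]

theorem nextPlay_even_wait (he : Even h.index) {δ : ℝ≥0} (ht : σ h = .wait δ)
    {s : State L X P} (hs : G.Timed δ h.last s) :
    G.nextPlay σ ⟨h, none⟩ = some ⟨h.extend s, none⟩ := by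
  have h1 := (hs.of_le le_rfl).2.1
  have h2 : s = ⟨h.last.loc, h.last.val.delay δ⟩ := hs.unique (hs.of_le le_rfl)
  subst h2
  have h3 : (G.inv h.last.loc).sat (h.last.val.delay δ) := h1
  simp [nextPlay, he, ht, h3]

theorem exists_timed_of_nextPlay_even (he : Even h.index) (hl : h.last ∈ G.stateSpace) {d : ℝ≥0∞}
    (ht : σ h = .wait d) {p : PlayState L X P A} (hp : G.nextPlay σ ⟨h, none⟩ = some p) :
    ∃ (δ : ℝ≥0) (s : State L X P), d = δ ∧ G.Timed δ h.last s ∧ p = ⟨h.extend s, none⟩ := by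
  simp only [nextPlay, he, ht, if_true] at hp
  split_ifs at hp with hd
  refine ⟨d.toNNReal, ⟨h.last.loc, h.last.val.delay d.toNNReal⟩, (ENNReal.coe_toNNReal hd.1).symm,
    ⟨hl, hd.2, rfl, rfl⟩, ?_⟩
  simpa using hp.symm

theorem nextPlay_odd_act (he : ¬ Even h.index) {t : Transition L X P A} (ht : σ h = .act t) :
    G.nextPlay σ ⟨h, none⟩ = some ⟨h.extend (t.fire h.last), none⟩ := by
  simp only [nextPlay, he, ht, if_false]

theorem nextPlay_odd_wait (he : ¬ Even h.index) {d : ℝ≥0∞} (ht : σ h = .wait d) :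
    G.nextPlay σ ⟨h, none⟩ = none := by
  simp only [nextPlay, he, ht, if_false]

theorem isHistory_null (hh : G.IsHistory h) (he : Even h.index) : G.IsHistory (h.extend h.last) :=
  .timed h 0 _ hh he (timed_zero hh.last_mem)

end Play

/-! ### Attractors -/

/-- States from which some controllable transition leads to `B`. -/
def ctrlPred (G : PTG L X P A) (B : Set (State L X P)) : Set (State L X P) :=
  {s | ∃ t ∈ G.ctrl, s ∈ G.pred t B}

/-- States from which some uncontrollable transition leads to `B`. -/
def unctrlPred (G : PTG L X P A) (B : Set (State L X P)) : Set (State L X P) :=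
  {s | ∃ t ∈ G.unctrl, s ∈ G.pred t B}

/-- The states from which the controller can force a visit to `R` within `n - 1` discrete
transitions. The timed steps lead to a controllable transition into the next attractor and avoid
all uncontrollable transitions that leave it. -/
def attractor (G : PTG L X P A) (R : Set L) : ℕ → Set (State L X P)
  | 0 => ∅
  | n + 1 => {s | s ∈ G.stateSpace ∧ s.loc ∈ R} ∪
      G.safePred (G.ctrlPred (G.attractor R n)) (G.unctrlPred (G.attractor R n)ᶜ)

theorem ctrlPred_mono {B C : Set (State L X P)} (h : B ⊆ C) : G.ctrlPred B ⊆ G.ctrlPred C :=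
  fun _ ⟨t, ht, s', hs', hd⟩ => ⟨t, ht, s', h hs', hd⟩

theorem unctrlPred_mono {B C : Set (State L X P)} (h : B ⊆ C) : G.unctrlPred B ⊆ G.unctrlPred C :=
  fun _ ⟨t, ht, s', hs', hd⟩ => ⟨t, ht, s', h hs', hd⟩

theorem safePred_mono {B B' C C' : Set (State L X P)} (hB : B ⊆ B') (hC : C' ⊆ C) :
    G.safePred B C ⊆ G.safePred B' C' :=
  fun _ ⟨s', hs', δ, hδ, hcov⟩ =>
    ⟨s', hB hs', δ, hδ, Set.subset_empty_iff.1 (hcov ▸ Set.inter_subset_inter_right _ hC)⟩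

theorem attractor_mono (G : PTG L X P A) (R : Set L) : Monotone (G.attractor R) := by
  refine monotone_nat_of_le_succ fun n => ?_
  induction n with
  | zero => exact Set.empty_subset _
  | succ n ih =>
    exact Set.union_subset_union_right _ (safePred_mono (ctrlPred_mono ih)
      (unctrlPred_mono (Set.compl_subset_compl.2 ih)))

theorem safePred_safePred_subset {B C C' : Set (State L X P)} (hC : C' ⊆ C) :
    G.safePred (G.safePred B C) C' ⊆ G.safePred B C' := by
  rintro s ⟨s₁, ⟨s₂, hs₂, δ₂, h₂, hcov₂⟩, δ₁, h₁, hcov₁⟩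
  refine ⟨s₂, hs₂, δ₁ + δ₂, h₁.trans h₂, Set.eq_empty_iff_forall_notMem.2 ?_⟩
  rintro w ⟨⟨e, he, hw⟩, hwC⟩
  rcases le_total e δ₁ with hle | hle
  · exact Set.eq_empty_iff_forall_notMem.1 hcov₁ w ⟨⟨e, hle, hw⟩, hwC⟩
  · obtain ⟨e', rfl⟩ := exists_add_of_le hle
    refine Set.eq_empty_iff_forall_notMem.1 hcov₂ w
      ⟨⟨e', le_of_add_le_add_left he, h₁.2.1, hw.2.1, hw.2.2.1.trans h₁.2.2.1.symm, ?_⟩, hC hwC⟩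
    rw [hw.2.2.2, h₁.2.2.2]
    simp [GameVal.delay, add_assoc]

/-- A state in `newWin` may delay into `Win[ξ]` itself. The round is completed by the delay that put
that state into an attractor, so that the sum of both is followed by a discrete transition. -/
theorem newWin_subset_attractor {c : G.AlgState} {n : ℕ} (hc : ∀ ξ, c.win ξ ⊆ G.attractor R n)
    {ξ : G.SymState} (hξ : G.IsNode ξ) : G.newWin ξ c ⊆ G.attractor R (n + 1) := by
  rintro s ⟨⟨s₁, hs₁, δ, hδ, hcov⟩, hsξ⟩
  have hcov' : G.coverStep s δ ∩ G.unctrlPred (G.attractor R n)ᶜ = ∅ := by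
    refine Set.eq_empty_iff_forall_notMem.2 ?_
    rintro w ⟨⟨e, he, hw⟩, t, ht, z, hz, hd⟩
    have hwξ := hξ.closed s hsξ e w hw
    exact Set.eq_empty_iff_forall_notMem.1 hcov w ⟨⟨e, he, hw⟩, t, ht, hd.2.2.1.symm.trans hwξ.1,
      z, ⟨mem_post hwξ hd, fun h => hz (hc _ h)⟩, hd⟩
  rcases hs₁ with hs₁ | ⟨t, ht, -, s₂, hs₂, hd⟩
  · cases n with
    | zero => exact (hc ξ hs₁).elim
    | succ n =>
      rcases hc ξ hs₁ with ⟨-, hR⟩ | hsp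
      · exact .inl ⟨hδ.1, by rwa [← hδ.2.2.1]⟩
      · have hmono := attractor_mono G R (Nat.le_succ n)
        have hsub := unctrlPred_mono (G := G) (Set.compl_subset_compl.2 hmono)
        exact .inr (safePred_mono (ctrlPred_mono hmono) subset_rfl
          (safePred_safePred_subset hsub ⟨s₁, hsp, δ, hδ, hcov'⟩))
  · exact .inr ⟨s₁, ⟨t, ht, s₂, hc _ hs₂, hd⟩, δ, hδ, hcov'⟩

theorem Execution.win_subset_attractor (E : G.Execution R) (n : ℕ) (ξ : G.SymState) :
    (E.conf n).win ξ ⊆ G.attractor R n := by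
  induction n generalizing ξ with
  | zero => rw [E.start]; exact Set.empty_subset _
  | succ n ih =>
    have hc := E.consistent n
    have hs := E.step n
    have hmono := attractor_mono G R (Nat.le_succ n)
    generalize E.conf (n + 1) = c', E.conf n = c, E.act n = a at *
    cases hs with
    | explore η hη =>
      by_cases hne : ξ = η
      · subst hne
        by_cases hR : ξ.loc ∈ R
        · rw [exploreWin_self hR]
          intro s hs
          exact .inl ⟨mem_stateSpace_of_mem_states hs, by rwa [hs.1]⟩
        · rw [exploreWin_of_not_mem hR]
          exact (ih ξ).trans hmono
      · rw [exploreWin_of_ne hne]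
        exact (ih ξ).trans hmono
    | update η hη =>
      change G.updateWin η c ξ ⊆ _
      by_cases hne : ξ = η
      · subst hne
        rw [updateWin_self]
        exact Set.union_subset ((ih ξ).trans hmono)
          (newWin_subset_attractor ih (hc.node_explored ξ (hc.update_subset hη)))
      · rw [updateWin_of_ne hne]
        exact (ih ξ).trans hmono
    | done => exact (ih ξ).trans hmono

/-! ### The controller wins from the attractors -/

/-- A single delay from `s` that suits every attractor containing `s`; it is chosen for the least
possible index, and infinite if there is no suitable delay. After a finite delay the controller
has a transition into an attractor, as `IsStrategy` demands. -/
theorem exists_attractor_delay (G : PTG L X P A) (R : Set L) (s : State L X P) :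
    ∃ d : ℝ≥0∞, (∀ δ : ℝ≥0, d = δ → ∀ s', G.Timed δ s s' →
        ∃ n, s' ∈ G.ctrlPred (G.attractor R n)) ∧
      ∀ n, s ∈ G.attractor R (n + 1) → s.loc ∉ R → ∃ (δ : ℝ≥0) (s' : State L X P), d = δ ∧
        G.Timed δ s s' ∧ s' ∈ G.ctrlPred (G.attractor R n) ∧
        G.coverStep s δ ∩ G.unctrlPred (G.attractor R n)ᶜ = ∅ := by
  classical
  by_cases hex : ∃ n, s ∈ G.safePred (G.ctrlPred (G.attractor R n))
      (G.unctrlPred (G.attractor R n)ᶜ)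
  · obtain ⟨s', hs', δ, hδ, hcov⟩ := Nat.find_spec hex
    refine ⟨δ, fun δ' he u hu => ?_, fun n hn hR => ?_⟩
    · obtain rfl : δ = δ' := by exact_mod_cast he
      exact ⟨_, hu.unique hδ ▸ hs'⟩
    · have hn' := Nat.find_min' hex (hn.resolve_left fun h => hR h.2)
      have hmono := attractor_mono G R hn'
      exact ⟨δ, s', rfl, hδ, ctrlPred_mono hmono hs', Set.subset_empty_iff.1
        (hcov ▸ Set.inter_subset_inter_right _ (unctrlPred_mono (Set.compl_subset_compl.2 hmono)))⟩
  · refine ⟨⊤, fun δ' he => absurd he ENNReal.top_ne_coe, fun n hn hR => ?_⟩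
    exact absurd ⟨n, hn.resolve_left fun h => hR h.2⟩ hex

/-- There is a controllable transition from `s` that leads into the lowest attractor reachable by
one; `Move.wait ⊤` stands for its absence. -/
theorem exists_attractor_transition (G : PTG L X P A) (R : Set L) (s : State L X P) :
    ∃ m : Move L X P A, (∀ t, m = .act t → t ∈ G.ctrl ∧ ∃ s', G.Disc t s s') ∧
      ∀ n, s ∈ G.ctrlPred (G.attractor R n) → ∃ t, m = .act t ∧ s ∈ G.pred t (G.attractor R n) := by
  classical
  by_cases hex : ∃ n, s ∈ G.ctrlPred (G.attractor R n)
  · obtain ⟨t, ht, s', hs', hd⟩ := Nat.find_spec hex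
    refine ⟨.act t, fun t' he => ?_, fun n hn => ?_⟩
    · cases he
      exact ⟨ht, s', hd⟩
    · exact ⟨t, rfl, s', attractor_mono G R (Nat.find_min' hex hn) hs', hd⟩
  · exact ⟨.wait ⊤, nofun, fun n hn => absurd ⟨n, hn⟩ hex⟩

/-- A visit to `R` at an even position makes the run winning: the coverage contains that position
whether or not the run continues, as every step from it is timed. -/
theorem winningRun_of_even {σ : History L X P → Move L X P A} {s : State L X P} {i : ℕ}
    {h : History L X P} (hp : G.play σ s (2 * i) = some ⟨h, none⟩) (he : Even h.index)
    (hh : G.IsHistory h) (hR : h.last.loc ∈ R) : G.WinningRun R (G.inducedRun σ s) := by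
  have hr : G.inducedRun σ s (2 * i) = some h.last := by simp [inducedRun, hp]
  have hnext : G.play σ s (2 * i + 1) = G.nextPlay σ ⟨h, none⟩ := by simp [play, hp]
  have h0 := timed_zero hh.last_mem
  refine ⟨h.last, ?_, hR⟩
  have hstep : ∀ (δ : ℝ≥0) (u : State L X P) o, G.Timed δ h.last u →
      G.nextPlay σ ⟨h, none⟩ = some ⟨h.extend u, o⟩ → h.last ∈ G.coverRun (G.inducedRun σ s) := by
    intro δ u o hu hn
    refine .inl ⟨i, h.last, u, δ, hr, ?_, hu, 0, zero_le, h0⟩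
    simp [inducedRun, hnext, hn, History.extend]
  cases hσ : σ h with
  | act t => exact hstep 0 h.last _ h0 (nextPlay_even_act he hσ)
  | wait d =>
    cases hn : G.nextPlay σ ⟨h, none⟩ with
    | none => exact .inr ⟨2 * i, h.last, hr, by simp [inducedRun, hnext, hn], 0, h0⟩
    | some p =>
      obtain ⟨δ, u, -, hu, rfl⟩ := exists_timed_of_nextPlay_even he hh.last_mem hσ hn
      exact hstep δ u _ hu hn

/-- The strategy depends only on the last state and the parity of the history. Each round that it
plays, of a timed and a discrete step, lowers the index of the attractor. -/
theorem winning_of_mem_attractor {n : ℕ} {s : State L X P} (hs : s ∈ G.attractor R n) :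
    G.Winning R s := by
  classical
  choose d hd hdn using exists_attractor_delay G R
  choose a ha han using exists_attractor_transition G R
  let σc : History L X P → Move L X P A := fun h =>
    if Even h.index then .wait (d h.last) else a h.last
  have hσc : G.IsStrategy G.ctrl σc := by
    refine ⟨fun h _ t ht => ?_, fun h hh he δ s hδ hs => ?_⟩
    · by_cases he : Even h.index
      · simp [σc, he] at ht
      · simp only [σc, he, if_false] at ht
        obtain ⟨htc, s', hs'⟩ := ha _ t ht
        exact ⟨htc, hs'.available⟩
    · simp only [σc, he, if_true, Move.wait.injEq] at hδ
      obtain ⟨n, hn⟩ := hd _ δ hδ s hs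
      obtain ⟨t, ht, -⟩ := han s n hn
      refine ⟨t, ?_⟩
      have : ¬ Even (h.extend s).index := by
        rw [History.index_extend, Nat.even_add_one, not_not]; exact he
      simp only [σc, this, if_false]
      exact ht
  have hspace : s ∈ G.stateSpace := by
    cases n with
    | zero => exact hs.elim
    | succ n => exact hs.elim (fun h => h.1) fun ⟨_, _, _, h, _⟩ => h.1
  refine ⟨hspace, σc, hσc, fun σe hσe => ?_⟩
  set σ := globalStrategy σc σe with hσ
  suffices key : ∀ n i (h : History L X P), G.play σ s (2 * i) = some ⟨h, none⟩ → Even h.index →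
      G.IsHistory h → h.last ∈ G.attractor R n → G.WinningRun R (G.inducedRun σ s) from
    key n 0 ⟨[], s⟩ rfl (by simp [History.index]) (.start s hspace) hs
  intro n
  induction n with
  | zero => intro i h _ _ _ hl; exact hl.elim
  | succ n ih =>
    intro i h hp he hh hl
    by_cases hR : h.last.loc ∈ R
    · exact winningRun_of_even hp he hh hR
    obtain ⟨δ, s', hdδ, hδ, hs', hcov⟩ := hdn _ n hl hR
    have hnext : G.play σ s (2 * (i + 1)) = (G.nextPlay σ ⟨h, none⟩).bind (G.nextPlay σ) := by
      simp [play, hp, Nat.mul_add]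
    have hσch : σc h = .wait δ := by simp [σc, he, hdδ]
    have hesc : ∀ e ≤ δ, ∀ w, G.Timed e h.last w → ∀ t ∈ G.unctrl, G.Disc t w (t.fire w) →
        t.fire w ∈ G.attractor R n := by
      intro e he w hw t ht hd
      by_contra hn
      exact Set.eq_empty_iff_forall_notMem.1 hcov w ⟨⟨e, he, hw⟩, t, ht, _, hn, hd⟩
    have hodd : ∀ u, ¬ Even (h.extend u).index := fun u => by
      rw [History.index_extend, Nat.even_add_one, not_not]; exact he
    have heven : ∀ u u', Even ((h.extend u).extend u').index := fun u u' => by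
      rw [History.index_extend, Nat.even_add_one]; exact hodd u
    cases hσeh : σe h with
    | act t =>
      obtain ⟨ht, hdisc⟩ := hσe.disc hh hσeh
      have hσh : σ h = .act t := by simp [hσ, globalStrategy, hσeh]
      rw [nextPlay_even_act he hσh] at hnext
      refine ih (i + 1) _ hnext (heven _ _) ?_ (hesc 0 zero_le _ (timed_zero hh.last_mem) t ht hdisc)
      exact .disc _ t _ (isHistory_null hh he) (Nat.not_even_iff_odd.1 (hodd _)) (.inr ht) hdisc
    | wait d' =>
      obtain ⟨e, hed⟩ : ∃ e : ℝ≥0, min d' (δ : ℝ≥0∞) = e :=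
        ⟨(min d' δ).toNNReal, (ENNReal.coe_toNNReal (by simp)).symm⟩
      have heδ : e ≤ δ := by
        have := min_le_right d' (δ : ℝ≥0∞)
        rw [hed] at this
        exact_mod_cast this
      have hσh : σ h = .wait e := by simp [hσ, globalStrategy, hσeh, hσch, ← hed, min_comm]
      obtain ⟨w, hw⟩ : ∃ w, G.Timed e h.last w := ⟨_, hδ.of_le heδ⟩
      rw [nextPlay_even_wait he hσh hw] at hnext
      have hh' : G.IsHistory (h.extend w) := .timed h e w hh he hw
      have hfin : ∀ t ∈ G.ctrl ∪ G.unctrl, σ (h.extend w) = .act t → G.Disc t w (t.fire w) →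
          t.fire w ∈ G.attractor R n → G.WinningRun R (G.inducedRun σ s) := by
        intro t ht hσt hdisc hmem
        have hnext' := hnext.trans (nextPlay_odd_act (hodd w) hσt)
        exact ih (i + 1) _ hnext' (heven _ _)
          (.disc _ t _ hh' (Nat.not_even_iff_odd.1 (hodd _)) ht hdisc) hmem
      cases hσe' : σe (h.extend w) with
      | act t =>
        obtain ⟨ht, hdisc⟩ := hσe.disc hh' hσe'
        exact hfin t (.inr ht) (by simp [hσ, globalStrategy, hσe']) hdisc
          (hesc e heδ w hw t ht hdisc)
      | wait d'' =>
        -- The environment does not move after its own delay, so the controller's delay was taken.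
        have hlt : ¬ d' ≤ δ := by
          intro hle
          rw [min_eq_left hle] at hed
          subst hed
          obtain ⟨t, ht⟩ := hσe.altern h hh he e w hσeh hw
          rw [hσe'] at ht
          cases ht
        have heq : δ = e := by
          rw [min_eq_right (le_of_not_ge hlt)] at hed
          exact_mod_cast hed
        subst heq
        obtain rfl := hw.unique hδ
        obtain ⟨t, hat, z, hz, hdisc⟩ := han w n hs'
        have hσc' : σc (h.extend w) = .act t := by
          simp only [σc, hodd, if_false]
          exact hat
        obtain rfl := hdisc.eq_fire
        exact hfin t (.inl (ha w t hat).1) (by simp [hσ, globalStrategy, hσe', hσc']) hdisc hz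

/-! ### The environment wins from traps -/

/-- If `V` avoids `R` and every controllable transition that can be reached by a delay from a
state of `V` either leads to `V` or can be forestalled by an uncontrollable one into `V`, then
no state of `V` is winning. -/
theorem not_winning_of_trap {V : Set (State L X P)} (hV : ∀ s ∈ V, s ∈ G.stateSpace ∧ s.loc ∉ R)
    (htrap : ∀ s ∈ V, ∀ δ s', G.Timed δ s s' → ∀ t ∈ G.ctrl, ∀ s'', G.Disc t s' s'' →
      s'' ∈ V ∨ ∃ w ∈ G.coverStep s δ, w ∈ G.unctrlPred V)
    {s : State L X P} (hs : s ∈ V) : ¬ G.Winning R s := by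
  classical
  rintro ⟨-, σc, hσc, hwin⟩
  -- The environment takes uncontrollable transitions into `V` at once, and delays until such
  -- a transition only if the controller would not act before.
  let limit : History L X P → ℝ≥0∞ := fun h => match σc h with
    | .wait d => d
    | .act _ => 0
  let Ambush : History L X P → ℝ≥0 → Prop := fun h e =>
    Even h.index ∧ e ≤ limit h ∧ ∃ w, G.Timed e h.last w ∧ w ∈ G.unctrlPred V
  have hex : ∀ h : History L X P, ∃ m : Move L X P A,
      (h.last ∈ G.unctrlPred V → ∃ t ∈ G.unctrl, m = .act t ∧ h.last ∈ G.pred t V) ∧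
      (h.last ∉ G.unctrlPred V → ∃ d, m = .wait d ∧ (∀ e : ℝ≥0, d = e → Ambush h e) ∧
        (d = ⊤ → ∀ e, ¬ Ambush h e)) := by
    intro h
    by_cases hu : h.last ∈ G.unctrlPred V
    · obtain ⟨t, ht, hp⟩ := hu
      exact ⟨.act t, fun _ => ⟨t, ht, rfl, hp⟩, fun hn => absurd ⟨t, ht, hp⟩ hn⟩
    · by_cases he : ∃ e, Ambush h e
      · obtain ⟨e, he⟩ := he
        refine ⟨.wait e, fun hn => absurd hn hu, fun _ => ⟨e, rfl, fun e' hee => ?_, fun ht => ?_⟩⟩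
        · obtain rfl : e = e' := by exact_mod_cast hee
          exact he
        · exact absurd ht ENNReal.coe_ne_top
      · exact ⟨.wait ⊤, fun hn => absurd hn hu, fun _ =>
          ⟨⊤, rfl, fun e hee => absurd hee ENNReal.top_ne_coe, fun _ e h => he ⟨e, h⟩⟩⟩
  choose σe hact hwait using hex
  have hσe : G.IsStrategy G.unctrl σe := by
    refine ⟨fun h _ t ht => ?_, fun h hh he δ u hδ hu => ?_⟩
    · by_cases hl : h.last ∈ G.unctrlPred V
      · obtain ⟨t', ht', hm, z, -, hd⟩ := hact h hl
        obtain rfl : t' = t := by rw [hm] at ht; injection ht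
        exact ⟨ht', hd.available⟩
      · obtain ⟨d, hm, -⟩ := hwait h hl
        rw [hm] at ht; cases ht
    · by_cases hl : h.last ∈ G.unctrlPred V
      · obtain ⟨t', -, hm, -⟩ := hact h hl
        rw [hm] at hδ; cases hδ
      · obtain ⟨d, hm, hd, -⟩ := hwait h hl
        obtain rfl : d = δ := by rw [hm] at hδ; injection hδ
        obtain ⟨-, -, w, hw, hwV⟩ := hd δ rfl
        obtain rfl := hw.unique hu
        obtain ⟨t, -, ht, -⟩ := hact (h.extend w) hwV
        exact ⟨t, ht⟩
  set σ := globalStrategy σc σe with hσ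
  let Good : PlayState L X P A → Prop := fun p =>
    p.pending = none ∧ Even p.hist.index ∧ G.IsHistory p.hist ∧ p.hist.last ∈ V
  have hstep : ∀ p, Good p → ∀ p₁, G.nextPlay σ p = some p₁ → p₁.hist.last.loc ∉ R ∧
      ∀ p₂, G.nextPlay σ p₁ = some p₂ → Good p₂ := by
    rintro ⟨h, o⟩ ⟨rfl, he, hh, hl⟩ p₁ hp₁
    dsimp only at he hh hl
    have hodd : ∀ u, ¬ Even (h.extend u).index := fun u => by
      rw [History.index_extend, Nat.even_add_one, not_not]; exact he
    have heven : ∀ u u', Even ((h.extend u).extend u').index := fun u u' => by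
      rw [History.index_extend, Nat.even_add_one]; exact hodd u
    have hnull : ∀ t ∈ G.ctrl ∪ G.unctrl, σ h = .act t → G.Disc t h.last (t.fire h.last) →
        t.fire h.last ∈ V → p₁.hist.last.loc ∉ R ∧ ∀ p₂, G.nextPlay σ p₁ = some p₂ → Good p₂ := by
      intro t ht hσt hd hV'
      rw [nextPlay_even_act he hσt, Option.some.injEq] at hp₁
      subst hp₁
      refine ⟨(hV _ hl).2, fun p₂ hp₂ => ?_⟩
      rw [nextPlay_pending, Option.some.injEq] at hp₂
      subst hp₂
      exact ⟨rfl, heven _ _, .disc _ t _ (isHistory_null hh he)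
        (Nat.not_even_iff_odd.1 (hodd _)) ht hd, hV'⟩
    by_cases hlu : h.last ∈ G.unctrlPred V
    · obtain ⟨t, ht, hm, z, hz, hd⟩ := hact h hlu
      obtain rfl := hd.eq_fire
      exact hnull t (.inr ht) (by simp [hσ, globalStrategy, hm]) hd hz
    obtain ⟨d, hm, hde, hdtop⟩ := hwait h hlu
    cases hc : σc h with
    | act t =>
      obtain ⟨ht, hd⟩ := hσc.disc hh hc
      refine hnull t (.inl ht) (by simp [hσ, globalStrategy, hm, hc]) hd ?_
      -- The transition is preceded by a null delay, so only `h.last` itself is covered.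
      refine (htrap _ hl 0 _ (timed_zero hh.last_mem) t ht _ hd).resolve_right ?_
      rintro ⟨w, ⟨e, he0, hw⟩, hwV⟩
      obtain rfl : e = 0 := le_antisymm he0 zero_le
      obtain rfl := hw.unique (timed_zero hh.last_mem)
      exact hlu hwV
    | wait c =>
      have hlim : limit h = c := by simp [limit, hc]
      have hσh : σ h = .wait (min c d) := by simp [hσ, globalStrategy, hm, hc]
      obtain ⟨e, w, hmin, hw, rfl⟩ := exists_timed_of_nextPlay_even he hh.last_mem hσh hp₁
      refine ⟨by dsimp only [History.extend]; rw [hw.2.2.1]; exact (hV _ hl).2, fun p₂ hp₂ => ?_⟩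
      have hh' : G.IsHistory (h.extend w) := .timed h e w hh he hw
      have hfin : ∀ t ∈ G.ctrl ∪ G.unctrl, σ (h.extend w) = .act t → G.Disc t w (t.fire w) →
          t.fire w ∈ V → Good p₂ := by
        intro t ht hσt hd hV'
        rw [nextPlay_odd_act (hodd w) hσt, Option.some.injEq] at hp₂
        subst hp₂
        exact ⟨rfl, heven _ _, .disc _ t _ hh' (Nat.not_even_iff_odd.1 (hodd _)) ht hd, hV'⟩
      by_cases hwu : w ∈ G.unctrlPred V
      · obtain ⟨t, ht, hm', z, hz, hd⟩ := hact (h.extend w) hwu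
        obtain rfl := hd.eq_fire
        exact hfin t (.inr ht) (by simp [hσ, globalStrategy, hm']) hd hz
      obtain ⟨d', hm', -⟩ := hwait (h.extend w) hwu
      cases hc' : σc (h.extend w) with
      | wait c' =>
        rw [nextPlay_odd_wait (d := min c' d') (hodd w)
          (by simp [hσ, globalStrategy, hm', hc'])] at hp₂
        cases hp₂
      | act t =>
        obtain ⟨ht, hd⟩ := hσc.disc hh' hc'
        refine hfin t (.inl ht) (by simp [hσ, globalStrategy, hm', hc']) hd ?_
        refine (htrap _ hl e w hw t ht _ hd).resolve_right ?_
        rintro ⟨w', ⟨e', he', hw'⟩, hwV'⟩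
        -- An ambush at `e' ≤ e` would have made the environment's delay at most the controller's,
        -- hence equal to `e`, and `w` the place of the ambush.
        have hec : (e : ℝ≥0∞) ≤ c := hmin ▸ min_le_left c d
        have hamb : Ambush h e' :=
          ⟨he, hlim ▸ le_trans (by exact_mod_cast he') hec, w', hw', hwV'⟩
        have hdt : d ≠ ⊤ := fun hd => hdtop hd e' hamb
        obtain ⟨-, hle, w₀, hw₀, hwV₀⟩ := hde d.toNNReal (ENNReal.coe_toNNReal hdt).symm
        rw [ENNReal.coe_toNNReal hdt, hlim] at hle
        rw [min_eq_right hle] at hmin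
        subst hmin
        rw [ENNReal.toNNReal_coe] at hw₀
        obtain rfl := hw.unique hw₀
        exact hwu hwV₀
  have hgood : ∀ i p, G.play σ s (2 * i) = some p → Good p := by
    intro i
    induction i with
    | zero =>
      intro p hp
      simp only [play, Option.some.injEq] at hp
      subst hp
      exact ⟨rfl, by simp [History.index], .start s (hV s hs).1, hs⟩
    | succ i ih =>
      intro p hp
      have hn : G.play σ s (2 * (i + 1)) =
          ((G.play σ s (2 * i)).bind (G.nextPlay σ)).bind (G.nextPlay σ) := rfl
      rw [hn, Option.bind_eq_some_iff] at hp
      obtain ⟨p₁, hp₁, hp⟩ := hp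
      rw [Option.bind_eq_some_iff] at hp₁
      obtain ⟨p₀, hp₀, hp₁⟩ := hp₁
      exact (hstep p₀ (ih p₀ hp₀) p₁ hp₁).2 p hp
  have hloc : ∀ n u, G.inducedRun σ s n = some u → u.loc ∉ R := by
    intro n u hu
    rw [inducedRun, Option.map_eq_some_iff] at hu
    obtain ⟨p, hp, rfl⟩ := hu
    rcases Nat.even_or_odd' n with ⟨i, rfl | rfl⟩
    · exact (hV _ (hgood i p hp).2.2.2).2
    · rw [play, Option.bind_eq_some_iff] at hp
      obtain ⟨p₀, hp₀, hp⟩ := hp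
      exact (hstep p₀ (hgood i p₀ hp₀) p hp).1
  obtain ⟨u, hu, hR⟩ := hwin σe hσe
  rcases hu with ⟨i, v, v', δ, hv, -, -, e, -, ht⟩ | ⟨n, v, hv, -, e, ht⟩
  · exact hloc _ v hv (by rwa [← ht.2.2.1])
  · exact hloc _ v hv (by rwa [← ht.2.2.1])

/-! ### Correctness of the algorithm -/

/-- In a fair execution, winning states of explored symbolic states are eventually found: those
that are never found form a trap. -/
theorem Execution.exists_mem_win {E : G.Execution R} (hE : E.Fair) {n : ℕ} {ξ : G.SymState}
    (hξ : ξ ∈ (E.conf n).explored) {s : State L X P} (hs : s ∈ ξ.states) (hw : G.Winning R s) :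
    ∃ N, s ∈ (E.conf N).win ξ := by
  by_contra! hnot
  let V : Set (State L X P) := {s | ∃ ξ, (∃ n, ξ ∈ (E.conf n).explored) ∧ s ∈ ξ.states ∧
    ∀ N, s ∉ (E.conf N).win ξ}
  refine not_winning_of_trap (V := V) ?_ ?_ ⟨ξ, ⟨n, hξ⟩, hs, hnot⟩ hw
  · rintro s ⟨ξ, ⟨n, hn⟩, hs, hnot⟩
    refine ⟨mem_stateSpace_of_mem_states hs, fun hR => hnot n ?_⟩
    rw [hs.1] at hR
    rwa [(E.consistent n).win_target ξ hn hR]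
  · rintro s ⟨ξ, ⟨n, hn⟩, hs, hnot⟩ δ s' hδ t ht s'' hd
    by_contra! hcon
    obtain ⟨hV'', hcov⟩ := hcon
    obtain ⟨m, hm, hstab⟩ := exists_update_stable hE hn s.val.param
    have hnode := (E.consistent n).node_explored ξ hn
    have hs' := hnode.closed s hs δ s' hδ
    have hsucc : ∀ w ∈ ξ.states, ∀ u ∈ G.ctrl ∪ G.unctrl, ∀ z, G.Disc u w z →
        u.source = ξ.loc ∧ G.IsSucc ξ (G.post u ξ) := fun w hw u hu z hz =>
      have hl := hz.2.2.1.symm.trans hw.1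
      ⟨hl, u, hu, hl, rfl⟩
    -- At time `m`, the winning sets of the successors contain all states with the parameters
    -- of `s` that they ever will; hence `s` is found by the update of `ξ`.
    have hwin : ∀ w ∈ ξ.states, ∀ u ∈ G.ctrl ∪ G.unctrl, ∀ z, G.Disc u w z →
        w.val.param = s.val.param → z ∉ V → z ∈ (E.conf m).win (G.post u ξ) := by
      intro w hw u hu z hz hp hzV
      obtain ⟨-, hS⟩ := hsucc w hw u hu z hz
      by_contra hn'
      refine hzV ⟨_, exists_explored_of_isSucc hE hn hS, mem_post hw hz, fun N hN => hn' ?_⟩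
      exact hstab _ hS N z hN (hz.param_eq.trans hp)
    have hstep := E.step m
    rw [hm] at hstep
    have hnew : s ∈ G.newWin ξ (E.conf m) := by
      refine ⟨⟨s', .inr ⟨t, ht, (hsucc s' hs' t (.inl ht) s'' hd).1, s'',
        hwin s' hs' t (.inl ht) s'' hd hδ.param_eq hV'', hd⟩, δ, hδ,
        Set.eq_empty_iff_forall_notMem.2 ?_⟩, hs⟩
      rintro w ⟨⟨e, he, hw⟩, u, hu, -, z, ⟨-, hzn⟩, hz⟩
      have hwξ := hnode.closed s hs e w hw
      refine hcov w ⟨e, he, hw⟩ ⟨u, hu, z, ?_, hz⟩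
      by_contra hzV
      exact hzn (hwin w hwξ u (.inr hu) z hz hw.param_eq hzV)
    refine hnot (m + 1) ?_
    rw [hstep.of_update.2]
    change s ∈ G.updateWin ξ _ ξ
    rw [updateWin_self]
    exact .inr hnew

theorem Execution.winningParam_sound (E : G.Execution R) (n : ℕ) {p : P → ℚ≥0}
    (hp : p ∈ (E.conf n).winningParam) : G.WinningParam R p := by
  induction n with
  | zero => rw [E.start] at hp; exact hp.elim
  | succ n ih =>
    have hs := E.step n
    have hsub := E.win_subset_attractor (n + 1)
    generalize E.conf (n + 1) = c', E.conf n = c, E.act n = a at *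
    cases hs with
    | explore ξ hξ => exact ih hp
    | update ξ hξ =>
      obtain ⟨s, ⟨hs, hs₀⟩, rfl⟩ := hp
      exact ⟨s, hs₀, rfl, winning_of_mem_attractor (hsub ξ hs)⟩
    | done => exact ih hp

/-- An initial state that enters a winning set is reported: this happens either in an update, which
reports it, or in an exploration, after which an update is due. -/
theorem Execution.exists_mem_winningParam {E : G.Execution R} (hE : E.Fair) {N : ℕ}
    {ξ : G.SymState} {s : State L X P} (hs : s ∈ (E.conf N).win ξ) (hs₀ : s ∈ G.initStates) :
    ∃ n, s.val.param ∈ (E.conf n).winningParam := by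
  have hreport : ∀ m, E.act m = some (.update ξ) → s ∈ (E.conf (m + 1)).win ξ →
      s.val.param ∈ (E.conf (m + 1)).winningParam := by
    intro m hm hsm
    have hstep := E.step m
    rw [hm] at hstep
    rw [hstep.of_update.2] at hsm ⊢
    exact ⟨s, ⟨hsm, hs₀⟩, rfl⟩
  induction N with
  | zero => rw [E.start] at hs; exact hs.elim
  | succ N ih =>
    by_cases hN : s ∈ (E.conf N).win ξ
    · exact ih hN
    have hstep := E.step N
    have hmove : E.act N = some (.update ξ) ∨ ξ ∈ (E.conf (N + 1)).waitingUpdate := by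
      generalize E.conf (N + 1) = c', E.conf N = c, E.act N = a at hs hN hstep ⊢
      cases hstep with
      | explore η hη =>
        by_cases hne : ξ = η
        · exact .inr (.inr hne)
        · rw [exploreWin_of_ne hne] at hs
          exact absurd hs hN
      | update η hη =>
        by_cases hne : ξ = η
        · exact .inl (by rw [hne])
        · change s ∈ G.updateWin η c ξ at hs
          rw [updateWin_of_ne hne] at hs
          exact absurd hs hN
      | done => exact absurd hs hN
    rcases hmove with hm | hm
    · exact ⟨_, hreport N hm hs⟩
    · obtain ⟨m, hle, hm⟩ := hE.2 _ ξ hm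
      exact ⟨_, hreport m hm (E.win_mono ξ (hle.trans (Nat.le_succ m)) hs)⟩

end PTG

theorem mainTheorem4 {L X P A : Type*} (G : PTG L X P A) (R : Set L) (E : G.Execution R) :
    (∀ n, ∀ p ∈ (E.conf n).winningParam, G.WinningParam R p) ∧
    (E.Fair →
      (∀ n, ∀ ξ ∈ (E.conf n).explored, ∀ s ∈ ξ.states, G.Winning R s →
        ∃ N, ∀ m ≥ N, s ∈ (E.conf m).win ξ) ∧
      (∀ p, G.WinningParam R p → ∃ n, p ∈ (E.conf n).winningParam)) := by
  refine ⟨fun n p hp => E.winningParam_sound n hp, fun hE => ⟨fun n ξ hξ s hs hw => ?_, ?_⟩⟩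
  · obtain ⟨N, hN⟩ := PTG.Execution.exists_mem_win hE hξ hs hw
    exact ⟨N, fun m hm => E.win_mono ξ hm hN⟩
  · rintro p ⟨s, hs₀, rfl, hw⟩
    obtain ⟨n, hn⟩ := PTG.Execution.exists_explored_of_waiting hE (n := 0)
      (ξ := G.tempSucc G.symInit) (by rw [E.start]; rfl)
    obtain ⟨N, hN⟩ :=
      PTG.Execution.exists_mem_win hE hn (PTG.mem_init_of_mem_initStates hs₀) hw
    exact PTG.Execution.exists_mem_winningParam hE hN hs₀
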